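/- Let $(\mathbb B,|\cdot|)$ be a separable real Banach space and let $\psi_2(x)=|x|^2$. Assume that $\mathbb B$ belongs to the class $\widetilde{\mathcal C}_2(2,\tilde c_2)$, that is, $\psi_2$ is two times differentiable (all first and second directional derivatives exist at every point) and $$|D^2\psi_2(x)(u,v)|\le \tilde c_2\,|u|\,|v|\qquad\text{for all }x,u,v\in\mathbb B,$$ where $D^2\psi_2(x)(u,v)$ is the second derivative of $\psi_2$ at $x$ in the directions $u,v$. Let $n\ge 1$, let $\mathcal F_1\subset\dots\subset\mathcal F_n$ be $\sigma$-algebras on a probability space, and let $Y_1,\dots,Y_n$ be $\mathbb B$-valued random variables such that, for every $k\in\{1,\dots,n\}$, $Y_k$ is $\mathcal F_k$-measurable and $\mathbb P(|Y_k|\le M)=1$. Let $S_k=\sum_{i=1}^kY_i$, let $K=\sqrt{\max(\tilde c_2,1)}$ and, for $k\in\{0,\dots,n-1\}$, let $$\theta(k)=\max\big\{\mathbb E\big(|\mathbb E(Y_i\mid\mathcal F_{i-k})|\big):\ i\in\{k+1,\dots,n\}\big\}.$$ Then, for any $q\in\{1,\dots,n\}$ and any real $x>0$ with $x\ge qM$,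 $$\mathbb P\Big(\max_{1\le k\le n}|S_k|\ge 4x\Big)\le\frac{n\,\theta(q)}{x}\mathbf 1_{q<n}+\frac{4\tilde c_2K^2nM}{x^2}\sum_{k=0}^{q-1}\theta(k).$$ In addition, for any $p\in[1,2)$, the variable $\max_{1\le k\le n}|S_k|^p$ is integrable and $$\mathbb E\Big(\max_{1\le k\le n}|S_k|^p\Big)\le\Big(4^pp+\frac{4^{p+1}p\,\tilde c_2K^2}{2-p}\Big)M^{p-1}n\sum_{k=0}^{n-1}(k+1)^{p-2}\theta(k);$$ in particular the same bound holds with $(k+1)\theta(k)$ in place of $(k+1)^{p-2}\theta(k)$. -/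

import Mathlib

open MeasureTheory

noncomputable section

namespace SmoothBanach

/-- The function `ψ_p(x) = |x|^p` on a normed space. -/
def psi (B : Type*) [NormedAddCommGroup B] (p : ℝ) (x : B) : ℝ := ‖x‖ ^ p

/-- The first derivative of `g` at `x` in the direction `u`, as a function of `x`. -/
def dirDeriv {B : Type*} [NormedAddCommGroup B] [NormedSpace ℝ B] (g : B → ℝ) (u : B) : B → ℝ :=
  fun x => lineDeriv ℝ g x u

/-- `D²g(x)(u, v)`: the second derivative of `g` at `x` in the directions `u`, `v`. -/
def secondDirDeriv {B : Type*} [NormedAddCommGroup B] [NormedSpace ℝ B] (g : B → ℝ)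
    (x u v : B) : ℝ :=
  lineDeriv ℝ (dirDeriv g u) x v

/-- Membership of `B` in the class `C̃₂(p, c)`: the function `ψ_p` is two times differentiable (all
first and second directional derivatives exist) and
`|D²ψ_p(x)(u, v)| ≤ c |x|^(p-2) |u| |v|` for all `x, u, v`.

Differentiability is directional: if `p = 2`, requiring a second Fréchet derivative at the origin
would force the norm to be Hilbertian, whereas the class is meant to contain `L^q` for `q ≥ 2`. -/
structure ClassTilde (B : Type*) [NormedAddCommGroup B] [NormedSpace ℝ B] (p c : ℝ) : Prop where
  differentiable : ∀ x u : B, LineDifferentiableAt ℝ (psi B p) x u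
  differentiable_two : ∀ x u v : B, LineDifferentiableAt ℝ (dirDeriv (psi B p) u) x v
  bound : ∀ x u v : B,
    |secondDirDeriv (psi B p) x u v| ≤ c * ‖x‖ ^ (p - 2) * ‖u‖ * ‖v‖

/-- The partial sum `S_k = Y_1 + ⋯ + Y_k`. -/
def partialSum {Ω B : Type*} [NormedAddCommGroup B] (Y : ℕ → Ω → B) (k : ℕ) (ω : Ω) : B :=
  ∑ i ∈ Finset.Icc 1 k, Y i ω

/-- `max_{1 ≤ k ≤ n} |S_k|`, for `1 ≤ n`. -/
def maxPartialSum {Ω B : Type*} [NormedAddCommGroup B] (Y : ℕ → Ω → B) (n : ℕ) (ω : Ω) : ℝ :=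
  ⨆ k : Finset.Icc 1 n, ‖partialSum Y k ω‖

/-- `θ(k) = max { E |E(Y_i | F_{i-k})| : k + 1 ≤ i ≤ n }`, for `k < n`. -/
def theta {Ω B : Type*} [MeasurableSpace Ω] [NormedAddCommGroup B] [NormedSpace ℝ B]
    [CompleteSpace B] (μ : Measure Ω) (F : ℕ → MeasurableSpace Ω) (Y : ℕ → Ω → B) (n k : ℕ) : ℝ :=
  ⨆ i : Finset.Icc (k + 1) n, ∫ ω, ‖(μ[Y i | F (i - k)]) ω‖ ∂μ

end SmoothBanach

end

namespace SmoothBanach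

/-! The bound on the second derivative makes the gradient of `‖·‖²` a `c`-Lipschitz map into the
dual, so that `‖x + u‖² ≤ ‖x‖² + grad x u + c ‖u‖²` (`norm_add_sq_le`). This inequality replaces
Hilbert space orthogonality, in two ways. For martingale differences the gradient term has mean
zero, which bounds the second moment of the sum by `c` times the sum of second moments, and Doob's
inequality passes to the maximum (`measure_max_martingale_le`). For a general bounded adapted
sequence the gradient at `S_r` is telescoped along the past; the increment at time `j` has norm at
most `cM` and is known at time `j`, so its pairing with the `r`th variable costs at most `cM θ(r -
j)` (`integral_norm_sum_sq_le`).

For the deviation inequality, cut the sum into blocks of length `q` and centre each block given the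
past up to the end of the block two places before. Blocks of one parity then form martingale
differences. The level `4x` is shared equally by the even blocks, the odd blocks, the sum of the
conditional expectations (Markov's inequality, giving `n θ(q) / x`) and the incomplete last block,
which is at most `qM ≤ x` (`ClassTilde.measure_max_sum_le`).

For the moments, divide the maximum by `4M` and integrate the tail against `p t^(p-1)`, with `q` the
integer part of `t` capped at `n`. The first-moment bound handles `t < 1`, and a trapezoidal
estimate recovers the stated constant (`lintegral_rpow_le_of_tail_le`). -/

theorem psi_two {B : Type*} [NormedAddCommGroup B] (x : B) : psi B 2 x = ‖x‖ ^ 2 := by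
  simp [psi]

/-! ### Calculus of the squared norm -/

section Smoothness

variable {B : Type*} [NormedAddCommGroup B] [NormedSpace ℝ B] {c : ℝ}

theorem hasDerivAt_comp_line {f : B → ℝ} {x v : B} {t : ℝ}
    (hf : LineDifferentiableAt ℝ f (x + t • v) v) :
    HasDerivAt (fun s : ℝ => f (x + s • v)) (lineDeriv ℝ f (x + t • v) v) t := by
  have h : HasDerivAt (fun s : ℝ => f (x + t • v + s • v)) (lineDeriv ℝ f (x + t • v) v)
      (t - t) := by
    rw [sub_self]
    exact hf.hasLineDerivAt
  have h2 := HasDerivAt.comp_sub_const t t h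
  refine h2.congr_of_eventuallyEq (Filter.Eventually.of_forall fun s => ?_)
  change f (x + s • v) = f (x + t • v + (s - t) • v)
  congr 1
  module

namespace ClassTilde

theorem hasDerivAt_psi (hB : ClassTilde B 2 c) (x u : B) (t : ℝ) :
    HasDerivAt (fun s : ℝ => psi B 2 (x + s • u)) (dirDeriv (psi B 2) u (x + t • u)) t :=
  hasDerivAt_comp_line (hB.differentiable (x + t • u) u)

theorem hasDerivAt_dirDeriv (hB : ClassTilde B 2 c) (x u v : B) (t : ℝ) :
    HasDerivAt (fun s : ℝ => dirDeriv (psi B 2) u (x + s • v))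
      (secondDirDeriv (psi B 2) (x + t • v) u v) t :=
  hasDerivAt_comp_line (hB.differentiable_two (x + t • v) u v)

theorem abs_secondDirDeriv_le (hB : ClassTilde B 2 c) (x u v : B) :
    |secondDirDeriv (psi B 2) x u v| ≤ c * ‖u‖ * ‖v‖ := by
  simpa using hB.bound x u v

theorem abs_dirDeriv_sub_le (hB : ClassTilde B 2 c) (x y u : B) :
    |dirDeriv (psi B 2) u y - dirDeriv (psi B 2) u x| ≤ c * ‖u‖ * ‖y - x‖ := by
  have h := Convex.norm_image_sub_le_of_norm_hasDerivWithin_le (𝕜 := ℝ)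
    (f := fun s : ℝ => dirDeriv (psi B 2) u (x + s • (y - x)))
    (f' := fun s : ℝ => secondDirDeriv (psi B 2) (x + s • (y - x)) u (y - x))
    (s := Set.univ) (x := 0) (y := 1) (C := c * ‖u‖ * ‖y - x‖)
    (fun t _ => (hB.hasDerivAt_dirDeriv x u (y - x) t).hasDerivWithinAt)
    (fun t _ => by simpa using hB.abs_secondDirDeriv_le (x + t • (y - x)) u (y - x))
    convex_univ (Set.mem_univ _) (Set.mem_univ _)
  simpa using h

theorem dirDeriv_zero (u : B) : dirDeriv (psi B 2) u 0 = 0 := by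
  have h : HasLineDerivAt ℝ (psi B 2) 0 0 u := by
    rw [HasLineDerivAt]
    have : (fun t : ℝ => psi B 2 (0 + t • u)) = fun t : ℝ => t ^ 2 * ‖u‖ ^ 2 := by
      funext t
      rw [psi_two, zero_add, norm_smul, mul_pow, Real.norm_eq_abs, sq_abs]
    rw [this]
    simpa using ((hasDerivAt_id (0 : ℝ)).pow 2).mul_const (‖u‖ ^ 2)
  exact h.lineDeriv

theorem abs_dirDeriv_le (hB : ClassTilde B 2 c) (x u : B) :
    |dirDeriv (psi B 2) u x| ≤ c * ‖x‖ * ‖u‖ := by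
  have h := hB.abs_dirDeriv_sub_le 0 x u
  rw [dirDeriv_zero, sub_zero, sub_zero] at h
  linarith

/-- On a line through the origin the squared norm is `t² ‖u‖²`, whose second derivative is `2 ‖u‖²`.
Hence `max c 1 = c` and `K² = c` in the main theorem. -/
theorem two_le [Nontrivial B] (hB : ClassTilde B 2 c) : 2 ≤ c := by
  obtain ⟨u, hu⟩ := exists_ne (0 : B)
  have hu' : 0 < ‖u‖ := norm_pos_iff.2 hu
  have h := hB.abs_secondDirDeriv_le 0 u u
  have hd : ∀ t : ℝ, dirDeriv (psi B 2) u (0 + t • u) = 2 * t * ‖u‖ ^ 2 := by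
    intro t
    have h1 := hB.hasDerivAt_psi 0 u t
    have h2 : HasDerivAt (fun t : ℝ => psi B 2 (0 + t • u)) (2 * t * ‖u‖ ^ 2) t := by
      have : (fun t : ℝ => psi B 2 (0 + t • u)) = fun t : ℝ => t ^ 2 * ‖u‖ ^ 2 := by
        funext t
        rw [psi_two, zero_add, norm_smul, mul_pow, Real.norm_eq_abs, sq_abs]
      rw [this]
      simpa using ((hasDerivAt_id t).pow 2).mul_const (‖u‖ ^ 2)
    exact h1.unique h2
  have h1 := hB.hasDerivAt_dirDeriv 0 u u 0
  simp only [hd] at h1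
  have h2 : HasDerivAt (fun s : ℝ => 2 * s * ‖u‖ ^ 2) (2 * 1 * ‖u‖ ^ 2) 0 :=
    ((hasDerivAt_id (0 : ℝ)).const_mul 2).mul_const (‖u‖ ^ 2)
  have h3 := h1.unique h2
  rw [zero_smul, add_zero] at h3
  rw [h3, abs_of_nonneg (by positivity)] at h
  have : 2 * (‖u‖ * ‖u‖) ≤ c * (‖u‖ * ‖u‖) := by nlinarith
  exact le_of_mul_le_mul_right this (by positivity)

theorem nonneg [Nontrivial B] (hB : ClassTilde B 2 c) : 0 ≤ c := by
  linarith [hB.two_le]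

/-- The mean value theorem followed by the Lipschitz bound loses a factor 2 against the sharp `c /
2`; the final constants allow for it. -/
theorem abs_taylor_le (hB : ClassTilde B 2 c) [Nontrivial B] (x u : B) :
    |‖x + u‖ ^ 2 - ‖x‖ ^ 2 - dirDeriv (psi B 2) u x| ≤ c * ‖u‖ ^ 2 := by
  obtain ⟨t, ht, h⟩ := exists_hasDerivAt_eq_slope (fun s : ℝ => psi B 2 (x + s • u))
    (fun s : ℝ => dirDeriv (psi B 2) u (x + s • u)) zero_lt_one
    (fun s _ => (hB.hasDerivAt_psi x u s).continuousAt.continuousWithinAt)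
    (fun s _ => hB.hasDerivAt_psi x u s)
  simp only [one_smul, zero_smul, add_zero, sub_zero, div_one, psi_two] at h
  rw [← h]
  refine (hB.abs_dirDeriv_sub_le x (x + t • u) u).trans ?_
  have hc := hB.nonneg
  rw [add_sub_cancel_left, norm_smul, Real.norm_eq_abs, abs_of_pos ht.1]
  have : 0 ≤ c * ‖u‖ ^ 2 := by positivity
  nlinarith [ht.2]

/-- Directional derivatives need not be additive in the direction. Here they are: expanding `‖x +
t(u + v)‖²` in one step and in two steps gives the same value up to `O(t²)`, whereas a defect of
additivity would contribute `t δ`. -/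
theorem dirDeriv_add (hB : ClassTilde B 2 c) [Nontrivial B] (x u v : B) :
    dirDeriv (psi B 2) (u + v) x = dirDeriv (psi B 2) u x + dirDeriv (psi B 2) v x := by
  have hsm : ∀ (t : ℝ) (w y : B), dirDeriv (psi B 2) (t • w) y = t * dirDeriv (psi B 2) w y := by
    intro t w y
    simp [dirDeriv, lineDeriv_smul]
  set δ := dirDeriv (psi B 2) (u + v) x - dirDeriv (psi B 2) u x - dirDeriv (psi B 2) v x with hδ
  set C := c * ‖u + v‖ ^ 2 + c * ‖u‖ ^ 2 + c * ‖v‖ ^ 2 + c * ‖v‖ * ‖u‖ with hC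
  have hc := hB.nonneg
  have key : ∀ t : ℝ, 0 < t → |δ| ≤ C * t := by
    intro t ht
    have h1 := hB.abs_taylor_le x (t • (u + v))
    have h2 := hB.abs_taylor_le x (t • u)
    have h3 := hB.abs_taylor_le (x + t • u) (t • v)
    have h4 := hB.abs_dirDeriv_sub_le x (x + t • u) v
    rw [add_assoc, ← smul_add] at h3
    rw [add_sub_cancel_left] at h4
    simp only [hsm, norm_smul, Real.norm_eq_abs, abs_of_pos ht] at h1 h2 h3 h4
    rw [abs_le] at h1 h2 h3 h4
    have : |t * δ| ≤ t * (C * t) := by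
      rw [abs_le]
      constructor <;> nlinarith
    rw [abs_mul, abs_of_pos ht] at this
    exact le_of_mul_le_mul_left this ht
  have hlim : Filter.Tendsto (fun t : ℝ => C * t) (nhdsWithin 0 (Set.Ioi 0)) (nhds (C * 0)) :=
    ((continuous_const.mul continuous_id).tendsto 0).mono_left nhdsWithin_le_nhds
  have h0 : |δ| ≤ C * 0 :=
    ge_of_tendsto hlim (Filter.eventually_of_mem self_mem_nhdsWithin key)
  rw [mul_zero] at h0
  have := abs_nonpos_iff.1 h0
  linarith

/-- The derivative of `|·|²`, as a map into the dual space. -/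
noncomputable def grad [Nontrivial B] (hB : ClassTilde B 2 c) (x : B) : B →L[ℝ] ℝ :=
  LinearMap.mkContinuous
    { toFun := fun u => dirDeriv (psi B 2) u x
      map_add' := hB.dirDeriv_add x
      map_smul' := fun t u => by simp [dirDeriv, lineDeriv_smul] }
    (c * ‖x‖) (fun u => by simpa using hB.abs_dirDeriv_le x u)

variable [Nontrivial B]

theorem grad_apply (hB : ClassTilde B 2 c) (x u : B) :
    hB.grad x u = dirDeriv (psi B 2) u x := rfl

theorem grad_zero (hB : ClassTilde B 2 c) : hB.grad 0 = 0 := by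
  ext u
  exact dirDeriv_zero u

theorem norm_grad_sub_le (hB : ClassTilde B 2 c) (x y : B) :
    ‖hB.grad y - hB.grad x‖ ≤ c * ‖y - x‖ := by
  refine ContinuousLinearMap.opNorm_le_bound _ (mul_nonneg hB.nonneg (norm_nonneg _)) fun u => ?_
  rw [sub_apply, grad_apply, grad_apply, Real.norm_eq_abs]
  linarith [hB.abs_dirDeriv_sub_le x y u]

theorem norm_grad_le (hB : ClassTilde B 2 c) (x : B) : ‖hB.grad x‖ ≤ c * ‖x‖ := by
  simpa [grad_zero] using hB.norm_grad_sub_le 0 x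

theorem continuous_grad (hB : ClassTilde B 2 c) : Continuous hB.grad := by
  have : LipschitzWith ⟨c, hB.nonneg⟩ hB.grad := LipschitzWith.of_dist_le_mul fun x y => by
    rw [dist_eq_norm, dist_eq_norm]
    exact hB.norm_grad_sub_le y x
  exact this.continuous

theorem norm_add_sq_le (hB : ClassTilde B 2 c) (x u : B) :
    ‖x + u‖ ^ 2 ≤ ‖x‖ ^ 2 + hB.grad x u + c * ‖u‖ ^ 2 := by
  have := (abs_le.1 (hB.abs_taylor_le x u)).2
  rw [grad_apply]
  linarith

end ClassTilde

end Smoothness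

/-! ### Second moments and the maximal inequality -/

section Moments

theorem integrable_norm_sq {Ω B : Type*} [MeasurableSpace Ω] {μ : Measure Ω} [IsFiniteMeasure μ]
    [NormedAddCommGroup B] {X : Ω → B} (hX : MemLp X ⊤ μ) :
    Integrable (fun ω => ‖X ω‖ ^ 2) μ :=
  (hX.mono_exponent (p := 2) le_top).integrable_norm_pow two_ne_zero

variable {Ω B : Type*} {m : MeasurableSpace Ω} [mΩ : MeasurableSpace Ω] {μ : Measure Ω}
  [NormedAddCommGroup B] [NormedSpace ℝ B]

theorem integrable_clm_apply {A : Ω → B →L[ℝ] ℝ} {X : Ω → B} (hA : MemLp A ⊤ μ)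
    (hX : Integrable X μ) : Integrable (fun ω => A ω (X ω)) μ := by
  have hm : AEStronglyMeasurable (fun ω => A ω (X ω)) μ :=
    (ContinuousLinearMap.id ℝ (B →L[ℝ] ℝ)).aestronglyMeasurable_comp₂ hA.1 hX.1
  refine (hX.norm.const_mul (eLpNorm A ⊤ μ).toReal).mono' hm ?_
  filter_upwards [ae_le_eLpNormEssSup (f := A) (μ := μ)] with ω hω
  refine ((A ω).le_opNorm _).trans ?_
  gcongr
  rw [eLpNorm_exponent_top]
  have h2 : eLpNormEssSup A μ ≠ ⊤ := by
    rw [← eLpNorm_exponent_top]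
    exact hA.2.ne
  simpa using ENNReal.toReal_mono h2 hω

/-- The pull-out property for the duality pairing: a functional already known under `m` sees only
the conditional expectation. -/
theorem integral_clm_condExp [IsProbabilityMeasure μ] [CompleteSpace B] (hm : m ≤ mΩ)
    {A : Ω → B →L[ℝ] ℝ} {X : Ω → B} (hAm : StronglyMeasurable[m] A) (hA : MemLp A ⊤ μ)
    (hX : Integrable X μ) :
    ∫ ω, A ω (X ω) ∂μ = ∫ ω, A ω ((μ[X | m]) ω) ∂μ := by
  have h := condExp_bilin_of_stronglyMeasurable_left (ContinuousLinearMap.id ℝ (B →L[ℝ] ℝ))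
    hAm (integrable_clm_apply hA hX) hX
  rw [← integral_condExp hm]
  exact integral_congr_ae h

theorem integral_norm_condExp_sq_le [IsProbabilityMeasure μ] [CompleteSpace B] {X : Ω → B}
    (hX : MemLp X ⊤ μ) :
    ∫ ω, ‖(μ[X | m]) ω‖ ^ 2 ∂μ ≤ ∫ ω, ‖X ω‖ ^ 2 ∂μ := by
  have := integral_norm_condExp_rpow_le (m := m) (μ := μ) (f := X) one_le_two
    (by simpa using integrable_norm_sq hX)
  simpa using this

/-- Without orthogonality, centring is controlled by `‖a - b‖² ≤ 2‖a‖² + 2‖b‖²` and the contraction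
of conditional expectation; hence the factor 4. -/
theorem integral_norm_sub_condExp_sq_le [IsProbabilityMeasure μ] [CompleteSpace B] {X : Ω → B}
    (hX : MemLp X ⊤ μ) :
    ∫ ω, ‖X ω - (μ[X | m]) ω‖ ^ 2 ∂μ ≤ 4 * ∫ ω, ‖X ω‖ ^ 2 ∂μ := by
  have hE : MemLp (μ[X | m]) ⊤ μ := hX.condExp le_top
  calc ∫ ω, ‖X ω - (μ[X | m]) ω‖ ^ 2 ∂μ
      ≤ ∫ ω, (2 * ‖X ω‖ ^ 2 + 2 * ‖(μ[X | m]) ω‖ ^ 2) ∂μ := by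
        refine integral_mono (integrable_norm_sq (hX.sub hE))
          (((integrable_norm_sq hX).const_mul 2).add ((integrable_norm_sq hE).const_mul 2))
          fun ω => ?_
        have h1 := norm_sub_le (X ω) ((μ[X | m]) ω)
        have h2 := norm_nonneg (X ω - (μ[X | m]) ω)
        change ‖X ω - (μ[X | m]) ω‖ ^ 2 ≤ 2 * ‖X ω‖ ^ 2 + 2 * ‖(μ[X | m]) ω‖ ^ 2
        nlinarith [sq_nonneg (‖X ω‖ - ‖(μ[X | m]) ω‖)]
    _ = 2 * ∫ ω, ‖X ω‖ ^ 2 ∂μ + 2 * ∫ ω, ‖(μ[X | m]) ω‖ ^ 2 ∂μ := by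
        rw [integral_add ((integrable_norm_sq hX).const_mul 2)
          ((integrable_norm_sq hE).const_mul 2), integral_const_mul, integral_const_mul]
    _ ≤ _ := by linarith [integral_norm_condExp_sq_le (m := m) hX]

variable [Nontrivial B] {c : ℝ}

namespace ClassTilde

theorem memLp_grad_comp (hB : ClassTilde B 2 c) {S : Ω → B} (hS : MemLp S ⊤ μ) :
    MemLp (fun ω => hB.grad (S ω)) ⊤ μ :=
  hS.of_le_mul (hB.continuous_grad.comp_aestronglyMeasurable hS.1)
    (Filter.Eventually.of_forall fun ω => hB.norm_grad_le (S ω))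

theorem integral_norm_add_sq_le [IsProbabilityMeasure μ] (hB : ClassTilde B 2 c) {S X : Ω → B} (hS : MemLp S ⊤ μ)
    (hX : MemLp X ⊤ μ) :
    ∫ ω, ‖S ω + X ω‖ ^ 2 ∂μ ≤
      ∫ ω, ‖S ω‖ ^ 2 ∂μ + ∫ ω, hB.grad (S ω) (X ω) ∂μ + c * ∫ ω, ‖X ω‖ ^ 2 ∂μ := by
  have h1 := integrable_norm_sq hS
  have h2 := integrable_clm_apply (hB.memLp_grad_comp hS) (hX.integrable le_top)
  have h3 := (integrable_norm_sq hX).const_mul c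
  have h12 : Integrable (fun ω => ‖S ω‖ ^ 2 + hB.grad (S ω) (X ω)) μ := h1.add h2
  rw [← integral_const_mul, ← integral_add h1 h2, ← integral_add h12 h3]
  exact integral_mono (integrable_norm_sq (hS.add hX)) (h12.add h3)
    fun ω => hB.norm_add_sq_le (S ω) (X ω)

variable [IsProbabilityMeasure μ] [CompleteSpace B]

/-- Second moment of the partial sums of martingale differences; the first term is arbitrary. -/
theorem integral_norm_sum_martingaleDiff_sq_le (hB : ClassTilde B 2 c) {H : Filtration ℕ mΩ}
    {D : ℕ → Ω → B} (hD : StronglyAdapted H D) (hD_top : ∀ l, MemLp (D l) ⊤ μ)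
    (hD_zero : ∀ l, μ[D (l + 1) | H l] =ᵐ[μ] 0) (N : ℕ) :
    ∫ ω, ‖∑ i ∈ Finset.range N, D i ω‖ ^ 2 ∂μ ≤
      c * ∑ i ∈ Finset.range N, ∫ ω, ‖D i ω‖ ^ 2 ∂μ := by
  induction N with
  | zero => simp
  | succ r ih =>
    have hS : MemLp (fun ω => ∑ i ∈ Finset.range r, D i ω) ⊤ μ :=
      memLp_finsetSum _ fun i _ => hD_top i
    have h := hB.integral_norm_add_sq_le hS (hD_top r)
    have h0 : ∫ ω, hB.grad (∑ i ∈ Finset.range r, D i ω) (D r ω) ∂μ = 0 := by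
      -- The gradient vanishes at the origin, so the first term needs no centring. This is what lets
      -- the first block of each parity stay uncentred later.
      cases r with
      | zero => simp [grad_zero]
      | succ l =>
        have hm : StronglyMeasurable[H l] fun ω => ∑ i ∈ Finset.range (l + 1), D i ω :=
          Finset.stronglyMeasurable_fun_sum _ fun i hi =>
            (hD i).mono (H.mono (Nat.lt_succ_iff.1 (Finset.mem_range.1 hi)))
        rw [integral_clm_condExp (H.le l) (hB.continuous_grad.comp_stronglyMeasurable hm)
          (hB.memLp_grad_comp hS) ((hD_top (l + 1)).integrable le_top)]
        refine integral_eq_zero_of_ae ?_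
        filter_upwards [hD_zero l] with ω hω
        rw [hω]
        simp
    simp only [Finset.sum_range_succ]
    rw [mul_add]
    linarith

/-- Doob-type maximal inequality for martingale differences in a smooth Banach space. -/
theorem measure_max_martingale_le (hB : ClassTilde B 2 c) {H : Filtration ℕ mΩ}
    {D : ℕ → Ω → B} (hD : StronglyAdapted H D) (hD_top : ∀ l, MemLp (D l) ⊤ μ)
    (hD_zero : ∀ l, μ[D (l + 1) | H l] =ᵐ[μ] 0) {x : ℝ} (hx : 0 < x) (N : ℕ) :
    μ.real {ω | ∃ l ≤ N, x ≤ ‖∑ i ∈ Finset.range l, D i ω‖} ≤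
      c / x ^ 2 * ∑ i ∈ Finset.range N, ∫ ω, ‖D i ω‖ ^ 2 ∂μ := by
  cases N with
  | zero => simp [hx.not_ge]
  | succ N =>
    set T : ℕ → Ω → B := fun l ω => ∑ i ∈ Finset.range (l + 1), D i ω with hT
    have hT_top : ∀ l, MemLp (T l) ⊤ μ := fun l => memLp_finsetSum _ fun i _ => hD_top i
    have hTm : ∀ l, StronglyMeasurable[H l] (T l) := fun l =>
      Finset.stronglyMeasurable_fun_sum _ fun i hi =>
        (hD i).mono (H.mono (Nat.lt_succ_iff.1 (Finset.mem_range.1 hi)))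
    set f : ℕ → Ω → ℝ := fun l ω => ‖T l ω‖ ^ 2 with hf
    -- Conditional Jensen for this convex function makes the squared norms of the martingale a
    -- submartingale.
    have hconv : ConvexOn ℝ Set.univ (fun y : B => ‖y‖ ^ 2) :=
      (convexOn_norm convex_univ).pow (fun _ _ => norm_nonneg _) 2
    have hsub : Submartingale f H μ := by
      refine submartingale_nat (fun l => (hTm l).norm.pow 2)
        (fun l => integrable_norm_sq (hT_top l)) fun l => ?_
      have hJ := hconv.map_condExp_le_univ (H.le l) (μ := μ) (f := T (l + 1))
        (by fun_prop : Continuous fun y : B => ‖y‖ ^ 2).lowerSemicontinuous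
        ((hT_top (l + 1)).integrable le_top) (integrable_norm_sq (hT_top (l + 1)))
      have hadd : T (l + 1) = T l + D (l + 1) := by
        funext ω
        simp [hT, Finset.sum_range_succ _ (l + 1)]
      have hc : μ[T (l + 1) | H l] =ᵐ[μ] T l := by
        have h1 := condExp_add ((hT_top l).integrable le_top)
          ((hD_top (l + 1)).integrable le_top) (H l)
        rw [condExp_of_stronglyMeasurable (H.le l) (hTm l) ((hT_top l).integrable le_top)] at h1
        rw [hadd]
        filter_upwards [h1, hD_zero l] with ω h1 h2
        rw [h1, Pi.add_apply, h2, Pi.zero_apply, add_zero]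
      filter_upwards [hJ, hc] with ω h1 h2
      simp only [Function.comp, h2] at h1
      exact h1
    have hmax := maximal_ineq hsub (fun l ω => sq_nonneg _) (ε := ⟨x ^ 2, by positivity⟩) N
    set E := {ω | ((⟨x ^ 2, by positivity⟩ : NNReal) : ℝ) ≤
      (Finset.range (N + 1)).sup' Finset.nonempty_range_add_one fun k => f k ω} with hE
    have hEset : {ω | ∃ l ≤ N + 1, x ≤ ‖∑ i ∈ Finset.range l, D i ω‖} ⊆ E := by
      rintro ω ⟨l, hl, hxl⟩
      cases l with
      | zero => simp [hx.not_ge] at hxl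
      | succ l =>
        refine le_trans ?_ (Finset.le_sup' (fun k => f k ω)
          (Finset.mem_range.2 (Nat.lt_of_succ_le hl)))
        change x ^ 2 ≤ ‖∑ i ∈ Finset.range (l + 1), D i ω‖ ^ 2
        gcongr
    have hfi := hsub.integrable N
    have hle : ∫ ω in E, f N ω ∂μ ≤ ∫ ω, f N ω ∂μ :=
      setIntegral_le_integral hfi (Filter.Eventually.of_forall fun ω => sq_nonneg _)
    have hmom := hB.integral_norm_sum_martingaleDiff_sq_le hD hD_top hD_zero (N + 1)
    have hreal : x ^ 2 * μ.real E ≤ ∫ ω, f N ω ∂μ := by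
      have := ENNReal.toReal_mono ENNReal.ofReal_ne_top
        (hmax.trans (ENNReal.ofReal_le_ofReal hle))
      rw [ENNReal.toReal_mul,
        ENNReal.toReal_ofReal (integral_nonneg fun ω => sq_nonneg _)] at this
      exact this
    calc μ.real {ω | ∃ l ≤ N + 1, x ≤ ‖∑ i ∈ Finset.range l, D i ω‖}
        ≤ μ.real E := measureReal_mono hEset
      _ ≤ (∫ ω, f N ω ∂μ) / x ^ 2 := by
          rw [le_div_iff₀ (by positivity)]
          linarith
      _ ≤ (c * ∑ i ∈ Finset.range (N + 1), ∫ ω, ‖D i ω‖ ^ 2 ∂μ) / x ^ 2 := by gcongr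
      _ = _ := by ring

/-- Second moment of the partial sums of a bounded adapted sequence. -/
theorem integral_norm_sum_sq_le (hB : ClassTilde B 2 c) {G : Filtration ℕ mΩ} {X : ℕ → Ω → B}
    (hX : StronglyAdapted G X) {M : ℝ} (hM : ∀ i, ∀ᵐ ω ∂μ, ‖X i ω‖ ≤ M) {θ : ℕ → ℝ}
    (hθ : ∀ k i, ∫ ω, ‖(μ[X (i + k) | G i]) ω‖ ∂μ ≤ θ k) (q : ℕ) :
    ∫ ω, ‖∑ i ∈ Finset.range q, X i ω‖ ^ 2 ∂μ ≤
      q * (c * M * ∑ k ∈ Finset.range q, θ k) := by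
  have hc := hB.nonneg
  have hM0 : 0 ≤ M := by
    obtain ⟨ω, hω⟩ := (hM 0).exists
    exact (norm_nonneg _).trans hω
  have hθ0 : ∀ k, 0 ≤ θ k := fun k =>
    (integral_nonneg fun ω => norm_nonneg _).trans (hθ k 0)
  have hX_top : ∀ i, MemLp (X i) ⊤ μ := fun i =>
    memLp_top_of_bound ((hX i).mono (G.le i)).aestronglyMeasurable M (hM i)
  set S : ℕ → Ω → B := fun r ω => ∑ i ∈ Finset.range r, X i ω with hSdef
  have hS_top : ∀ r, MemLp (S r) ⊤ μ := fun r => memLp_finsetSum _ fun i _ => hX_top i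
  have hSsucc : ∀ r ω, S (r + 1) ω = S r ω + X r ω := fun r ω => Finset.sum_range_succ _ _
  -- The increment of the gradient is measurable at time `j`, so the `r`th variable may be replaced
  -- by its conditional expectation, at lag `r - j`. The Lipschitz bound on the gradient leaves `c
  -- ‖X j‖ ≤ cM` in front.
  have hgrad_incr : ∀ r j, j < r →
      ∫ ω, (hB.grad (S (j + 1) ω) - hB.grad (S j ω)) (X r ω) ∂μ ≤ c * M * θ (r - j) := by
    intro r j hj
    have hAm : StronglyMeasurable[G j] fun ω => hB.grad (S (j + 1) ω) - hB.grad (S j ω) := by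
      have h : ∀ k ≤ j + 1, StronglyMeasurable[G j] (S k) := fun k hk =>
        Finset.stronglyMeasurable_fun_sum _ fun i hi =>
          (hX i).mono (G.mono (by have := Finset.mem_range.1 hi; omega))
      exact (hB.continuous_grad.comp_stronglyMeasurable (h _ le_rfl)).sub
        (hB.continuous_grad.comp_stronglyMeasurable (h _ (Nat.le_succ _)))
    have hA := (hB.memLp_grad_comp (hS_top (j + 1))).sub (hB.memLp_grad_comp (hS_top j))
    rw [integral_clm_condExp (G.le j) hAm hA ((hX_top r).integrable le_top)]
    have h1 : ∫ ω, (hB.grad (S (j + 1) ω) - hB.grad (S j ω)) ((μ[X r | G j]) ω) ∂μ ≤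
        ∫ ω, c * M * ‖(μ[X r | G j]) ω‖ ∂μ := by
      refine integral_mono_ae (integrable_clm_apply hA integrable_condExp)
        (integrable_condExp.norm.const_mul _) ?_
      filter_upwards [hM j] with ω hω
      refine (Real.le_norm_self _).trans ((ContinuousLinearMap.le_opNorm _ _).trans ?_)
      gcongr
      refine (hB.norm_grad_sub_le _ _).trans ?_
      rw [hSsucc, add_sub_cancel_left]
      gcongr
    refine h1.trans ?_
    rw [integral_const_mul]
    gcongr
    have := hθ (r - j) j
    rwa [Nat.add_sub_cancel' hj.le] at this
  have hstep : ∀ r, ∫ ω, ‖S (r + 1) ω‖ ^ 2 ∂μ ≤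
      ∫ ω, ‖S r ω‖ ^ 2 ∂μ + c * M * ∑ k ∈ Finset.range (r + 1), θ k := by
    intro r
    have h := hB.integral_norm_add_sq_le (hS_top r) (hX_top r)
    have hsq : ∫ ω, ‖X r ω‖ ^ 2 ∂μ ≤ M * θ 0 := by
      have h0 := hθ 0 r
      rw [add_zero, condExp_of_stronglyMeasurable (G.le r) (hX r)
        ((hX_top r).integrable le_top)] at h0
      calc ∫ ω, ‖X r ω‖ ^ 2 ∂μ ≤ ∫ ω, M * ‖X r ω‖ ∂μ := by
            refine integral_mono_ae (integrable_norm_sq (hX_top r))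
              (((hX_top r).integrable le_top).norm.const_mul M) ?_
            filter_upwards [hM r] with ω hω
            rw [sq]
            gcongr
        _ ≤ M * θ 0 := by
            rw [integral_const_mul]
            gcongr
    have hgrad : ∫ ω, hB.grad (S r ω) (X r ω) ∂μ ≤
        c * M * ∑ k ∈ Finset.range r, θ (k + 1) := by
      -- Telescoping starts from `S 0 = 0`, where the gradient is zero.
      have htel : ∀ ω, hB.grad (S r ω) (X r ω) =
          ∑ j ∈ Finset.range r, (hB.grad (S (j + 1) ω) - hB.grad (S j ω)) (X r ω) := by
        intro ω
        rw [← sum_apply,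
          Finset.sum_range_sub (fun j => hB.grad (S j ω))]
        simp [hSdef, grad_zero]
      simp_rw [htel]
      have hint : ∀ j ∈ Finset.range r, Integrable
          (fun ω => (hB.grad (S (j + 1) ω) - hB.grad (S j ω)) (X r ω)) μ := fun j _ =>
        integrable_clm_apply
          ((hB.memLp_grad_comp (hS_top (j + 1))).sub (hB.memLp_grad_comp (hS_top j)))
          ((hX_top r).integrable le_top)
      rw [integral_finsetSum _ hint]
      calc _ ≤ ∑ j ∈ Finset.range r, c * M * θ (r - j) :=
            Finset.sum_le_sum fun j hj => hgrad_incr r j (Finset.mem_range.1 hj)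
        _ = c * M * ∑ k ∈ Finset.range r, θ (k + 1) := by
            rw [← Finset.mul_sum, ← Finset.sum_range_reflect]
            congr 1
            refine Finset.sum_congr rfl fun j hj => ?_
            have := Finset.mem_range.1 hj
            congr 1
            omega
    simp_rw [hSsucc]
    rw [Finset.sum_range_succ', mul_add]
    nlinarith [mul_le_mul_of_nonneg_left hsq hc]
  have hmain : ∀ r ≤ q, ∫ ω, ‖S r ω‖ ^ 2 ∂μ ≤ r * (c * M * ∑ k ∈ Finset.range q, θ k) := by
    intro r
    induction r with
    | zero => simp [hSdef]
    | succ r ih =>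
      intro hr
      have h1 := ih (by omega)
      have h2 : c * M * ∑ k ∈ Finset.range (r + 1), θ k ≤ c * M * ∑ k ∈ Finset.range q, θ k := by
        gcongr
        exact fun k _ _ => hθ0 k
      push_cast
      linarith [hstep r]
  exact hmain q le_rfl

end ClassTilde

end Moments

/-! ### Block decomposition and the deviation inequality -/

section Blocks

theorem sum_range_eq_sum_even_add_sum_odd {E : Type*} [AddCommMonoid E] (f : ℕ → E) (j : ℕ) :
    ∑ i ∈ Finset.range j, f i =
      ∑ l ∈ Finset.range ((j + 1) / 2), f (2 * l + 0) +
        ∑ l ∈ Finset.range (j / 2), f (2 * l + 1) := by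
  induction j with
  | zero => simp
  | succ j ih =>
    rw [Finset.sum_range_succ, ih]
    rcases Nat.even_or_odd' j with ⟨k, rfl | rfl⟩
    · rw [show (2 * k + 1 + 1) / 2 = k + 1 by omega, show (2 * k + 1) / 2 = k by omega,
        show 2 * k / 2 = k by omega, Finset.sum_range_succ]
      abel
    · rw [show (2 * k + 1 + 1 + 1) / 2 = k + 1 by omega,
        show (2 * k + 1 + 1) / 2 = k + 1 by omega, show (2 * k + 1) / 2 = k by omega,
        Finset.sum_range_succ _ k, add_assoc,
        ← Finset.sum_range_succ (fun l => f (2 * l + 1)) k]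

theorem sum_range_mul_eq_sum_blocks {E : Type*} [AddCommMonoid E] (f : ℕ → E) (q j : ℕ) :
    ∑ i ∈ Finset.range (j * q), f i =
      ∑ a ∈ Finset.range j, ∑ i ∈ Finset.range q, f (a * q + i) := by
  induction j with
  | zero => simp
  | succ j ih => rw [add_mul, one_mul, Finset.sum_range_add, ih, Finset.sum_range_succ]

variable {Ω B : Type*} [mΩ : MeasurableSpace Ω] {μ : Measure Ω} [NormedAddCommGroup B]
  {G : Filtration ℕ mΩ} {X : ℕ → Ω → B} {q : ℕ}

/-- The sum of the block of length `q` that starts at `j * q`. -/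
def blockSum (X : ℕ → Ω → B) (q j : ℕ) (ω : Ω) : B :=
  ∑ i ∈ Finset.range q, X (j * q + i) ω

theorem stronglyMeasurable_blockSum (hX : StronglyAdapted G X) (j : ℕ) :
    StronglyMeasurable[G ((j + 1) * q - 1)] (blockSum X q j) :=
  Finset.stronglyMeasurable_fun_sum _ fun i hi => (hX _).mono (G.mono (by
    have := Finset.mem_range.1 hi
    rw [add_mul, one_mul]
    omega))

theorem memLp_blockSum (hX : ∀ i, MemLp (X i) ⊤ μ) (j : ℕ) : MemLp (blockSum X q j) ⊤ μ :=
  memLp_finsetSum _ fun _ _ => hX _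

variable [NormedSpace ℝ B]

/-- The conditional expectation of a block given the past of the block before the preceding one;
zero for the first two blocks. -/
noncomputable def blockProj (μ : Measure Ω) (G : Filtration ℕ mΩ)
    (X : ℕ → Ω → B) (q : ℕ) : ℕ → Ω → B
  | 0 => 0
  | 1 => 0
  | j + 2 => μ[blockSum X q (j + 2) | G ((j + 1) * q - 1)]

theorem stronglyMeasurable_blockProj (j : ℕ) :
    StronglyMeasurable[G ((j + 1) * q - 1)] (blockProj μ G X q j) := by
  match j with
  | 0 => exact stronglyMeasurable_zero
  | 1 => exact stronglyMeasurable_zero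
  | j + 2 =>
    exact stronglyMeasurable_condExp.mono (G.mono (by gcongr; omega))

variable [CompleteSpace B]

/-- Tower property and `L¹` contraction. -/
theorem integral_norm_condExp_antitone {m₁ m₂ : MeasurableSpace Ω}
    (h₁₂ : m₁ ≤ m₂) (h₂ : m₂ ≤ mΩ) [SigmaFinite (μ.trim h₂)] (f : Ω → B) :
    ∫ ω, ‖(μ[f | m₁]) ω‖ ∂μ ≤ ∫ ω, ‖(μ[f | m₂]) ω‖ ∂μ := by
  have h := integral_norm_condExp_le (μ := μ) (m := m₁) (μ[f | m₂])
  have h' := condExp_condExp_of_le (f := f) (μ := μ) h₁₂ h₂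
  calc ∫ ω, ‖(μ[f | m₁]) ω‖ ∂μ = ∫ ω, ‖(μ[μ[f | m₂] | m₁]) ω‖ ∂μ := by
        refine integral_congr_ae ?_
        filter_upwards [h'] with ω hω
        rw [hω]
    _ ≤ _ := h

theorem memLp_blockProj (hX : ∀ i, MemLp (X i) ⊤ μ) (j : ℕ) : MemLp (blockProj μ G X q j) ⊤ μ := by
  match j with
  | 0 => exact MemLp.zero'
  | 1 => exact MemLp.zero'
  | j + 2 => exact (memLp_blockSum hX _).condExp le_top

variable [IsProbabilityMeasure μ]

theorem integral_norm_blockSum_sub_blockProj_sq_le (hX : ∀ i, MemLp (X i) ⊤ μ) (j : ℕ) :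
    ∫ ω, ‖blockSum X q j ω - blockProj μ G X q j ω‖ ^ 2 ∂μ ≤
      4 * ∫ ω, ‖blockSum X q j ω‖ ^ 2 ∂μ := by
  have h0 : 0 ≤ ∫ ω, ‖blockSum X q j ω‖ ^ 2 ∂μ := integral_nonneg fun ω => sq_nonneg _
  match j with
  | 0 => simp only [blockProj, Pi.zero_apply, sub_zero]; linarith
  | 1 => simp only [blockProj, Pi.zero_apply, sub_zero]; linarith
  | j + 2 => exact integral_norm_sub_condExp_sq_le (memLp_blockSum hX _)

theorem condExp_blockSum_sub_blockProj (hX : ∀ i, MemLp (X i) ⊤ μ) (j : ℕ) :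
    μ[fun ω => blockSum X q (j + 2) ω - blockProj μ G X q (j + 2) ω | G ((j + 1) * q - 1)]
      =ᵐ[μ] 0 := by
  have h := condExp_sub ((memLp_blockSum (q := q) hX (j + 2)).integrable le_top)
    (integrable_condExp (m := G ((j + 1) * q - 1)) (f := blockSum X q (j + 2)) (μ := μ))
    (G ((j + 1) * q - 1))
  rw [condExp_of_stronglyMeasurable (G.le _) stronglyMeasurable_condExp integrable_condExp] at h
  refine h.trans (Filter.Eventually.of_forall fun ω => ?_)
  simp

theorem integral_norm_blockProj_le (hX : ∀ i, MemLp (X i) ⊤ μ) {θ : ℕ → ℝ}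
    (hθ : ∀ k i, ∫ ω, ‖(μ[X (i + k) | G i]) ω‖ ∂μ ≤ θ k) (j : ℕ) :
    ∫ ω, ‖blockProj μ G X q j ω‖ ∂μ ≤ q * θ q := by
  have hθ0 : 0 ≤ (q : ℝ) * θ q := mul_nonneg (Nat.cast_nonneg _)
    ((integral_nonneg fun ω => norm_nonneg _).trans (hθ q 0))
  match j with
  | 0 => simpa [blockProj] using hθ0
  | 1 => simpa [blockProj] using hθ0
  | j + 2 =>
    have hsum : blockProj μ G X q (j + 2) =ᵐ[μ]
        ∑ i ∈ Finset.range q, μ[X ((j + 2) * q + i) | G ((j + 1) * q - 1)] := by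
      have := condExp_finsetSum (μ := μ) (s := Finset.range q)
        (f := fun i => X ((j + 2) * q + i)) (fun i _ => (hX _).integrable le_top)
        (G ((j + 1) * q - 1))
      refine Filter.EventuallyEq.trans ?_ this
      have hb : blockSum X q (j + 2) = ∑ i ∈ Finset.range q, X ((j + 2) * q + i) := by
        funext ω
        simp [blockSum]
      rw [blockProj, hb]
    calc ∫ ω, ‖blockProj μ G X q (j + 2) ω‖ ∂μ
        ≤ ∫ ω, ∑ i ∈ Finset.range q,
            ‖(μ[X ((j + 2) * q + i) | G ((j + 1) * q - 1)]) ω‖ ∂μ := by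
          refine integral_mono_ae ((memLp_blockProj hX _).integrable le_top).norm
            (integrable_finsetSum _ fun i _ => integrable_condExp.norm) ?_
          filter_upwards [hsum] with ω hω
          rw [hω, Finset.sum_apply]
          exact norm_sum_le _ _
      _ = ∑ i ∈ Finset.range q,
            ∫ ω, ‖(μ[X ((j + 2) * q + i) | G ((j + 1) * q - 1)]) ω‖ ∂μ :=
          integral_finsetSum _ fun i _ => integrable_condExp.norm
      _ ≤ ∑ i ∈ Finset.range q, θ q := by
          refine Finset.sum_le_sum fun i _ => ?_
          -- The lag is `q + 1 + i`, more than `q`; conditioning later, at lag exactly `q`, can only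
          -- increase the `L¹` norm.
          have h1 := integral_norm_condExp_antitone (μ := μ)
            (G.mono (show (j + 1) * q - 1 ≤ (j + 1) * q + i by omega)) (G.le _)
            (X ((j + 2) * q + i))
          refine h1.trans ?_
          have h2 := hθ q ((j + 1) * q + i)
          rwa [show (j + 1) * q + i + q = (j + 2) * q + i by ring] at h2
      _ = q * θ q := by simp

variable {c : ℝ} [Nontrivial B]

theorem ClassTilde.integral_norm_blockSum_sq_le (hB : ClassTilde B 2 c)
    (hX : StronglyAdapted G X) {M : ℝ} (hM : ∀ i, ∀ᵐ ω ∂μ, ‖X i ω‖ ≤ M) {θ : ℕ → ℝ}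
    (hθ : ∀ k i, ∫ ω, ‖(μ[X (i + k) | G i]) ω‖ ∂μ ≤ θ k) (j : ℕ) :
    ∫ ω, ‖blockSum X q j ω‖ ^ 2 ∂μ ≤ q * (c * M * ∑ k ∈ Finset.range q, θ k) := by
  -- Restart time at the beginning of the block; the lags are unchanged, so the same `θ` serves.
  let G' : Filtration ℕ mΩ :=
    { seq := fun i => G (j * q + i)
      mono' := fun a b hab => G.mono (by omega)
      le' := fun i => G.le _ }
  exact hB.integral_norm_sum_sq_le (G := G') (X := fun i => X (j * q + i))
    (fun i => hX (j * q + i)) (fun i => hM _) (fun k i => by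
      rw [← add_assoc]
      exact hθ k (j * q + i)) q

/-- Maximal inequality for the blocks of a given parity, after centering. -/
theorem ClassTilde.measure_max_sum_blocks_le (hB : ClassTilde B 2 c)
    (hX : StronglyAdapted G X) {M : ℝ} (hM : ∀ i, ∀ᵐ ω ∂μ, ‖X i ω‖ ≤ M) {θ : ℕ → ℝ}
    (hθ : ∀ k i, ∫ ω, ‖(μ[X (i + k) | G i]) ω‖ ∂μ ≤ θ k) {x : ℝ} (hx : 0 < x) (N r : ℕ) :
    μ.real {ω | ∃ l ≤ N, x ≤ ‖∑ i ∈ Finset.range l,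
        (blockSum X q (2 * i + r) ω - blockProj μ G X q (2 * i + r) ω)‖} ≤
      c / x ^ 2 * (N * (4 * (q * (c * M * ∑ k ∈ Finset.range q, θ k)))) := by
  have hX_top : ∀ i, MemLp (X i) ⊤ μ := fun i =>
    memLp_top_of_bound ((hX i).mono (G.le i)).aestronglyMeasurable M (hM i)
  -- Time is sampled at the ends of the blocks of one parity. The next block of that parity is two
  -- places later and is centred given exactly this past, so the differences are martingale
  -- differences.
  let H : Filtration ℕ mΩ :=
    { seq := fun l => G ((2 * l + r + 1) * q - 1)
      mono' := fun a b hab => G.mono (by gcongr)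
      le' := fun i => G.le _ }
  have hmax := hB.measure_max_martingale_le (H := H) (μ := μ)
    (D := fun l ω => blockSum X q (2 * l + r) ω - blockProj μ G X q (2 * l + r) ω)
    (fun l => (stronglyMeasurable_blockSum hX _).sub (stronglyMeasurable_blockProj _))
    (fun l => (memLp_blockSum hX_top _).sub (memLp_blockProj hX_top _))
    (fun l => by
      have := condExp_blockSum_sub_blockProj (q := q) (G := G) hX_top (2 * l + r)
      rw [show 2 * (l + 1) + r = 2 * l + r + 2 by ring]
      exact this) hx N
  refine hmax.trans ?_
  have hc := hB.nonneg
  gcongr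
  calc _ ≤ ∑ i ∈ Finset.range N, 4 * (q * (c * M * ∑ k ∈ Finset.range q, θ k)) := by
        refine Finset.sum_le_sum fun i _ => ?_
        have h1 := integral_norm_blockSum_sub_blockProj_sq_le (q := q) (G := G) hX_top (2 * i + r)
        have h2 := hB.integral_norm_blockSum_sq_le (q := q) hX hM hθ (2 * i + r)
        linarith
    _ = _ := by simp

/-- Deviation inequality for the partial sums of a bounded adapted sequence. -/
theorem ClassTilde.measure_max_sum_le (hB : ClassTilde B 2 c)
    (hX : StronglyAdapted G X) {M : ℝ} (hM : ∀ i, ∀ᵐ ω ∂μ, ‖X i ω‖ ≤ M) {θ : ℕ → ℝ}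
    (hθ : ∀ k i, ∫ ω, ‖(μ[X (i + k) | G i]) ω‖ ∂μ ≤ θ k) (hq : 1 ≤ q) {x : ℝ} (hx : 0 < x)
    (hqx : q * M ≤ x) (n : ℕ) :
    μ.real {ω | ∃ k ≤ n, 4 * x ≤ ‖∑ i ∈ Finset.range k, X i ω‖} ≤
      n * θ q / x + 4 * c ^ 2 * n * M / x ^ 2 * ∑ k ∈ Finset.range q, θ k := by
  have hX_top : ∀ i, MemLp (X i) ⊤ μ := fun i =>
    memLp_top_of_bound ((hX i).mono (G.le i)).aestronglyMeasurable M (hM i)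
  have hM0 : 0 ≤ M := by
    obtain ⟨ω, hω⟩ := (hM 0).exists
    exact (norm_nonneg _).trans hω
  have hθ0 : ∀ k, 0 ≤ θ k := fun k =>
    (integral_nonneg fun ω => norm_nonneg _).trans (hθ k 0)
  have hc := hB.nonneg
  set m := n / q with hm
  have hmq : (m : ℝ) * q ≤ n := by
    exact_mod_cast Nat.div_mul_le_self n q
  set d : ℕ → Ω → B := fun j ω => blockSum X q j ω - blockProj μ G X q j ω with hd
  set A : ℕ → ℕ → Set Ω := fun N r =>
    {ω | ∃ l ≤ N, x ≤ ‖∑ i ∈ Finset.range l, d (2 * i + r) ω‖} with hA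
  set R : Ω → ℝ := fun ω => ∑ j ∈ Finset.range m, ‖blockProj μ G X q j ω‖ with hR
  have hsub : ∀ᵐ ω ∂μ, (∃ k ≤ n, 4 * x ≤ ‖∑ i ∈ Finset.range k, X i ω‖) →
      ω ∈ A ((m + 1) / 2) 0 ∪ A (m / 2) 1 ∪ {ω | x ≤ R ω} := by
    filter_upwards [ae_all_iff.2 hM] with ω hω
    rintro ⟨k, hkn, hk⟩
    set j := k / q with hj
    have hjm : j ≤ m := Nat.div_le_div_right hkn
    have hkj : k = j * q + k % q := by rw [mul_comm]; exact (Nat.div_add_mod k q).symm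
    have htail : ‖∑ i ∈ Finset.range (k % q), X (j * q + i) ω‖ ≤ x := by
      calc _ ≤ ∑ i ∈ Finset.range (k % q), M := norm_sum_le_of_le _ fun i _ => hω _
        _ = (k % q : ℕ) * M := by simp
        _ ≤ q * M := by
            gcongr
            exact (Nat.mod_lt k (by omega)).le
        _ ≤ x := hqx
    have hblocks : ∑ i ∈ Finset.range (j * q), X i ω =
        ∑ l ∈ Finset.range ((j + 1) / 2), d (2 * l + 0) ω +
          ∑ l ∈ Finset.range (j / 2), d (2 * l + 1) ω +
          ∑ a ∈ Finset.range j, blockProj μ G X q a ω := by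
      rw [sum_range_mul_eq_sum_blocks, ← sum_range_eq_sum_even_add_sum_odd (fun i => d i ω),
        ← Finset.sum_add_distrib]
      refine Finset.sum_congr rfl fun a _ => ?_
      simp [hd, blockSum]
    have hRle : ‖∑ a ∈ Finset.range j, blockProj μ G X q a ω‖ ≤ R ω :=
      (norm_sum_le _ _).trans (Finset.sum_le_sum_of_subset_of_nonneg
        (Finset.range_mono hjm) fun _ _ _ => norm_nonneg _)
    -- If the even, odd and compensating sums are all below `x`, then together with the incomplete
    -- block (at most `x`) they stay strictly below `4x`.
    by_contra hcon
    simp only [Set.mem_union, not_or, hA, Set.mem_ofPred_eq, not_exists, not_and, not_le] at hcon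
    obtain ⟨⟨h0, h1⟩, h2⟩ := hcon
    have h0' := h0 ((j + 1) / 2) (by omega)
    have h1' := h1 (j / 2) (by omega)
    rw [hkj, Finset.sum_range_add, hblocks] at hk
    have t1 := norm_add_le (∑ l ∈ Finset.range ((j + 1) / 2), d (2 * l + 0) ω +
          ∑ l ∈ Finset.range (j / 2), d (2 * l + 1) ω +
          ∑ a ∈ Finset.range j, blockProj μ G X q a ω)
          (∑ i ∈ Finset.range (k % q), X (j * q + i) ω)
    have t2 := norm_add_le (∑ l ∈ Finset.range ((j + 1) / 2), d (2 * l + 0) ω +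
          ∑ l ∈ Finset.range (j / 2), d (2 * l + 1) ω)
          (∑ a ∈ Finset.range j, blockProj μ G X q a ω)
    have t3 := norm_add_le (∑ l ∈ Finset.range ((j + 1) / 2), d (2 * l + 0) ω)
          (∑ l ∈ Finset.range (j / 2), d (2 * l + 1) ω)
    linarith
  have hRint : Integrable R μ :=
    integrable_finsetSum _ fun j _ => ((memLp_blockProj hX_top j).integrable le_top).norm
  have hRmean : ∫ ω, R ω ∂μ ≤ n * θ q := by
    rw [integral_finsetSum _ fun j _ => ((memLp_blockProj hX_top j).integrable le_top).norm]
    calc _ ≤ ∑ j ∈ Finset.range m, (q : ℝ) * θ q :=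
          Finset.sum_le_sum fun j _ => integral_norm_blockProj_le hX_top hθ j
      _ = (m * q) * θ q := by simp [mul_assoc]
      _ ≤ n * θ q := by
          gcongr
          exact hθ0 q
  have hRprob : μ.real {ω | x ≤ R ω} ≤ n * θ q / x := by
    rw [le_div_iff₀ hx, mul_comm]
    exact (mul_meas_ge_le_integral_of_nonneg
      (Filter.Eventually.of_forall fun ω => Finset.sum_nonneg fun _ _ => norm_nonneg _)
      hRint x).trans hRmean
  have hA0 := hB.measure_max_sum_blocks_le (q := q) hX hM hθ hx ((m + 1) / 2) 0
  have hA1 := hB.measure_max_sum_blocks_le (q := q) hX hM hθ hx (m / 2) 1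
  have hmono : μ.real {ω | ∃ k ≤ n, 4 * x ≤ ‖∑ i ∈ Finset.range k, X i ω‖} ≤
      μ.real (A ((m + 1) / 2) 0 ∪ A (m / 2) 1 ∪ {ω | x ≤ R ω}) :=
    ENNReal.toReal_mono (measure_ne_top _ _) (measure_mono_ae hsub)
  have hu1 := measureReal_union_le (μ := μ) (A ((m + 1) / 2) 0 ∪ A (m / 2) 1) {ω | x ≤ R ω}
  have hu2 := measureReal_union_le (μ := μ) (A ((m + 1) / 2) 0) (A (m / 2) 1)
  set W := ∑ k ∈ Finset.range q, θ k with hW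
  have hW0 : 0 ≤ W := Finset.sum_nonneg fun k _ => hθ0 k
  -- The two parities share the `m` complete blocks, so the variance bounds add up to `m q ≤ n`
  -- terms.
  have hcount : (((m + 1) / 2 : ℕ) : ℝ) + ((m / 2 : ℕ) : ℝ) = m := by
    have : (m + 1) / 2 + m / 2 = m := by omega
    exact_mod_cast this
  have hfin : c / x ^ 2 * (((m + 1) / 2 : ℕ) * (4 * (q * (c * M * W)))) +
      c / x ^ 2 * ((m / 2 : ℕ) * (4 * (q * (c * M * W)))) ≤
      4 * c ^ 2 * n * M / x ^ 2 * W := by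
    calc _ = (((m + 1) / 2 : ℕ) + ((m / 2 : ℕ) : ℝ)) * q * (c / x ^ 2 * 4 * (c * M * W)) := by
          ring
      _ = m * q * (c / x ^ 2 * 4 * (c * M * W)) := by rw [hcount]
      _ ≤ n * (c / x ^ 2 * 4 * (c * M * W)) := by gcongr
      _ = _ := by ring
  linarith

end Blocks

/-! ### From tail bounds to moments -/

section TailIntegration

/-- Convexity of a nonpositive power, from two weighted AM-GM inequalities: `t` dominates the
geometric mean of the endpoints, the power reverses this, and the geometric mean of the powers is
below their arithmetic mean. -/
theorem rpow_le_chord {s : ℝ} (hs : s ≤ 0) {x t : ℝ} (hx : 0 < x) (h1 : x ≤ t) (h2 : t ≤ x + 1) :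
    t ^ s ≤ (x + 1 - t) * x ^ s + (t - x) * (x + 1) ^ s := by
  have hx1 : 0 < x + 1 := by linarith
  have hw1 : 0 ≤ x + 1 - t := by linarith
  have hw2 : 0 ≤ t - x := by linarith
  have g1 := Real.geom_mean_le_arith_mean2_weighted hw1 hw2 hx.le hx1.le (by ring)
  have g2 := Real.geom_mean_le_arith_mean2_weighted hw1 hw2 (Real.rpow_nonneg hx.le s)
    (Real.rpow_nonneg hx1.le s) (by ring)
  refine le_trans ?_ g2
  have ht : (x + 1 - t) * x + (t - x) * (x + 1) = t := by ring
  rw [ht] at g1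
  have hpos : 0 < x ^ (x + 1 - t) * (x + 1) ^ (t - x) :=
    mul_pos (Real.rpow_pos_of_pos hx _) (Real.rpow_pos_of_pos hx1 _)
  refine (Real.rpow_le_rpow_of_nonpos hpos g1 hs).trans (le_of_eq ?_)
  rw [Real.mul_rpow (Real.rpow_nonneg hx.le _) (Real.rpow_nonneg hx1.le _),
    ← Real.rpow_mul hx.le, ← Real.rpow_mul hx1.le, ← Real.rpow_mul hx.le, ← Real.rpow_mul hx1.le,
    mul_comm s, mul_comm s]

theorem lintegral_Ico_rpow_le {s : ℝ} (hs : s ≤ 0) {x C : ℝ} (hx : 0 < x) (hC : 0 ≤ C) :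
    ∫⁻ t in Set.Ico x (x + 1), ENNReal.ofReal (C * t ^ s) ≤
      ENNReal.ofReal (C * ((x ^ s + (x + 1) ^ s) / 2)) := by
  have hcont : Continuous fun t : ℝ =>
      C * ((x + 1 - t) * x ^ s + (t - x) * (x + 1) ^ s) := by fun_prop
  have hx1 : 0 < x + 1 := by linarith
  calc ∫⁻ t in Set.Ico x (x + 1), ENNReal.ofReal (C * t ^ s)
      ≤ ∫⁻ t in Set.Ico x (x + 1),
          ENNReal.ofReal (C * ((x + 1 - t) * x ^ s + (t - x) * (x + 1) ^ s)) := by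
        refine setLIntegral_mono (by fun_prop) fun t ht => ?_
        refine ENNReal.ofReal_le_ofReal (mul_le_mul_of_nonneg_left ?_ hC)
        exact rpow_le_chord hs hx ht.1 ht.2.le
    _ = ENNReal.ofReal (∫ t in Set.Ico x (x + 1),
          C * ((x + 1 - t) * x ^ s + (t - x) * (x + 1) ^ s)) := by
        rw [ofReal_integral_eq_lintegral_ofReal]
        · exact (hcont.integrableOn_Icc (μ := volume) (a := x) (b := x + 1)).mono_set
            Set.Ico_subset_Icc_self
        · refine (ae_restrict_iff' measurableSet_Ico).2 (Filter.Eventually.of_forall fun t ht => ?_)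
          have h1 : 0 ≤ x + 1 - t := by linarith [ht.2]
          have h2 : 0 ≤ t - x := by linarith [ht.1]
          have h3 := Real.rpow_nonneg hx.le s
          have h4 := Real.rpow_nonneg hx1.le s
          change 0 ≤ C * ((x + 1 - t) * x ^ s + (t - x) * (x + 1) ^ s)
          positivity
    _ = ENNReal.ofReal (C * ((x ^ s + (x + 1) ^ s) / 2)) := by
        congr 1
        rw [integral_Ico_eq_integral_Ioc, ← intervalIntegral.integral_of_le (by linarith)]
        have hder : ∀ t ∈ Set.uIcc x (x + 1), HasDerivAt
            (fun t : ℝ => C * (-((x + 1 - t) ^ 2 / 2) * x ^ s + (t - x) ^ 2 / 2 * (x + 1) ^ s))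
            (C * ((x + 1 - t) * x ^ s + (t - x) * (x + 1) ^ s)) t := by
          intro t _
          have e1 : HasDerivAt (fun t : ℝ => -((x + 1 - t) ^ 2 / 2)) (x + 1 - t) t := by
            have := ((((hasDerivAt_id t).const_sub (x + 1)).pow 2).div_const 2).neg
            refine this.congr_deriv ?_
            simp only [id]
            push_cast
            ring
          have e2 : HasDerivAt (fun t : ℝ => (t - x) ^ 2 / 2) (t - x) t := by
            have := (((hasDerivAt_id t).sub_const x).pow 2).div_const 2
            refine this.congr_deriv ?_
            simp
          exact ((e1.mul_const _).add (e2.mul_const _)).const_mul C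
        rw [intervalIntegral.integral_eq_sub_of_hasDerivAt hder
          (hcont.intervalIntegrable _ _)]
        ring

theorem lintegral_Ici_rpow_eq {s : ℝ} (hs : s < -1) {x C : ℝ} (hx : 0 < x) (hC : 0 ≤ C) :
    ∫⁻ t in Set.Ici x, ENNReal.ofReal (C * t ^ s) =
      ENNReal.ofReal (C * (x ^ (s + 1) / -(s + 1))) := by
  have hint : IntegrableOn (fun t : ℝ => C * t ^ s) (Set.Ioi x) :=
    (integrableOn_Ioi_rpow_of_lt hs hx).const_mul C
  rw [setLIntegral_congr Ioi_ae_eq_Ici.symm, ← ofReal_integral_eq_lintegral_ofReal hint,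
    integral_const_mul, integral_Ioi_rpow_of_lt hs hx]
  · congr 2
    rw [neg_div, div_neg]
  · refine (ae_restrict_iff' measurableSet_Ioi).2 (Filter.Eventually.of_forall fun t ht => ?_)
    exact mul_nonneg hC (Real.rpow_nonneg (hx.le.trans (le_of_lt ht)) _)

/-- Replacing `w k * θ (k + 1)` by `w k * θ k` leaves a sum in which the two end terms have weight
one half; the half missing at `k = 0` absorbs `θ 0 / 4`. Bounding each integral by its left endpoint
would leave no such room, for instance when `θ` is constant up to `m` and `w m < 1 / 4`. -/
theorem sum_trapezoid_le {θ w : ℕ → ℝ} (hθ0 : ∀ k, 0 ≤ θ k) (hθ : Antitone θ)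
    (hw : ∀ k, 0 ≤ w k) (hw0 : w 0 = 1) (m : ℕ) :
    θ 0 / 4 + ∑ k ∈ Finset.range m, θ (k + 1) * ((w k + w (k + 1)) / 2) ≤
      ∑ k ∈ Finset.range (m + 1), w k * θ k := by
  -- The half weight at the right end is kept so that the induction closes.
  suffices h : θ 0 / 4 + ∑ k ∈ Finset.range m, θ (k + 1) * ((w k + w (k + 1)) / 2) ≤
      ∑ k ∈ Finset.range (m + 1), w k * θ k - w m * θ m / 2 by
    linarith [mul_nonneg (hw m) (hθ0 m)]
  induction m with
  | zero =>
    simp only [Finset.range_zero, Finset.sum_empty, zero_add, Finset.sum_range_one, hw0]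
    linarith [hθ0 0]
  | succ m ih =>
    rw [Finset.sum_range_succ _ m, Finset.sum_range_succ _ (m + 1)]
    nlinarith [mul_le_mul_of_nonneg_left (hθ (Nat.le_succ m)) (hw m)]

variable {Ω : Type*} [MeasurableSpace Ω] {μ : Measure Ω} [IsFiniteMeasure μ]

theorem lintegral_rpow_le_of_tail_le {f : Ω → ℝ} (hf0 : ∀ ω, 0 ≤ f ω) (hfi : Integrable f μ)
    {θ : ℕ → ℝ} (hθ0 : ∀ k, 0 ≤ θ k) (hθ : Antitone θ) {a b : ℝ} (ha : 0 ≤ a) (hb : 0 ≤ b)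
    {m : ℕ} (hθm : θ (m + 1) = 0) (hmean : ∫ ω, f ω ∂μ ≤ a * (θ 0 / 4))
    (htail : ∀ q, 1 ≤ q → q ≤ m + 1 → ∀ y : ℝ, (q : ℝ) ≤ y →
      μ.real {ω | y ≤ f ω} ≤ a * θ q / y + b / y ^ 2 * ∑ k ∈ Finset.range q, θ k)
    {p : ℝ} (hp1 : 1 ≤ p) (hp2 : p < 2) :
    ∫⁻ ω, ENNReal.ofReal (f ω ^ p) ∂μ ≤
      ENNReal.ofReal (p * ((a + b / (2 - p)) *
        ∑ k ∈ Finset.range (m + 1), ((k : ℝ) + 1) ^ (p - 2) * θ k)) := by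
  have hp0 : 0 < p := by linarith
  have h2p : 0 < 2 - p := by linarith
  rw [lintegral_rpow_eq_lintegral_meas_le_mul μ (Filter.Eventually.of_forall hf0)
    hfi.aemeasurable hp0, ENNReal.ofReal_mul hp0.le]
  gcongr
  set w : ℕ → ℝ := fun k => ((k : ℝ) + 1) ^ (p - 2) with hw
  have hw0 : ∀ k, 0 ≤ w k := fun k => Real.rpow_nonneg (by positivity) _
  set I : ℕ → Set ℝ := fun k => Set.Ico ((k : ℝ) + 1) ((k : ℝ) + 1 + 1) with hI
  set J : ℕ → Set ℝ := fun k => Set.Ici ((k : ℝ) + 1) with hJ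
  -- With `q` the integer part of `t`, the Markov term contributes `u k` on the interval where `q =
  -- k + 1`. In the variance term `θ k` occurs as soon as `q > k`, hence the half-line carrying `v
  -- k`.
  set u : ℕ → ℝ → ENNReal := fun k => (I k).indicator
    fun t => ENNReal.ofReal (a * θ (k + 1) * t ^ (p - 2)) with hu
  set v : ℕ → ℝ → ENNReal := fun k => (J k).indicator
    fun t => ENNReal.ofReal (b * θ k * t ^ (p - 3)) with hv
  have hum : ∀ k, Measurable (u k) := fun k =>
    Measurable.indicator (by fun_prop) measurableSet_Ico
  have hvm : ∀ k, Measurable (v k) := fun k =>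
    Measurable.indicator (by fun_prop) measurableSet_Ici
  have hpoint : ∀ t ∈ Set.Ioi (0 : ℝ),
      μ {ω | t ≤ f ω} * ENNReal.ofReal (t ^ (p - 1)) ≤
        μ {ω | t ≤ f ω} + (∑ k ∈ Finset.range m, u k t + ∑ k ∈ Finset.range (m + 1), v k t) := by
    intro t ht
    have ht0 : 0 < t := ht
    -- Below 1 no `q ≥ 1` is admissible; there `t^(p-1) ≤ 1`, and the tail integrates to at most the
    -- mean.
    rcases lt_or_ge t 1 with ht1 | ht1
    · refine le_add_right ?_
      calc _ ≤ μ {ω | t ≤ f ω} * 1 := by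
            gcongr
            rw [ENNReal.ofReal_le_one]
            exact Real.rpow_le_one ht0.le ht1.le (by linarith)
        _ = _ := mul_one _
    · refine le_add_left ?_
      have hmul : ∀ q, 1 ≤ q → q ≤ m + 1 → (q : ℝ) ≤ t →
          μ {ω | t ≤ f ω} * ENNReal.ofReal (t ^ (p - 1)) ≤
            ENNReal.ofReal (a * θ q * t ^ (p - 2)) +
              ∑ k ∈ Finset.range q, ENNReal.ofReal (b * θ k * t ^ (p - 3)) := by
        intro q h1 h2 h3
        have h := htail q h1 h2 t h3
        have e1 : t ^ (p - 1) / t = t ^ (p - 2) := by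
          rw [← Real.rpow_sub_one ht0.ne']
          congr 1
          ring
        have e2 : t ^ (p - 1) / t ^ 2 = t ^ (p - 3) := by
          rw [← Real.rpow_sub_natCast ht0.ne']
          congr 1
          push_cast
          ring
        have hnn : ∀ k, 0 ≤ b * θ k * t ^ (p - 3) := fun k =>
          mul_nonneg (mul_nonneg hb (hθ0 k)) (Real.rpow_nonneg ht0.le _)
        rw [← ENNReal.ofReal_sum_of_nonneg fun k _ => hnn k, ← ENNReal.ofReal_add
          (mul_nonneg (mul_nonneg ha (hθ0 q)) (Real.rpow_nonneg ht0.le _))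
          (Finset.sum_nonneg fun k _ => hnn k), ← ofReal_measureReal,
          ← ENNReal.ofReal_mul measureReal_nonneg]
        refine ENNReal.ofReal_le_ofReal ?_
        calc μ.real {ω | t ≤ f ω} * t ^ (p - 1)
            ≤ (a * θ q / t + b / t ^ 2 * ∑ k ∈ Finset.range q, θ k) * t ^ (p - 1) := by
              gcongr
          _ = a * θ q * (t ^ (p - 1) / t) +
                b * (t ^ (p - 1) / t ^ 2) * ∑ k ∈ Finset.range q, θ k := by ring
          _ = _ := by
              rw [e1, e2, Finset.mul_sum]
              congr 1
              refine Finset.sum_congr rfl fun k _ => ?_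
              ring
      have hvk : ∀ q ≤ m + 1, (q : ℝ) ≤ t →
          ∑ k ∈ Finset.range q, ENNReal.ofReal (b * θ k * t ^ (p - 3)) ≤
            ∑ k ∈ Finset.range (m + 1), v k t := by
        intro q hq hqt
        refine (Finset.sum_le_sum fun k hk => ?_).trans
          (Finset.sum_le_sum_of_subset (Finset.range_mono hq))
        have hkt : t ∈ J k := by
          have : ((k + 1 : ℕ) : ℝ) ≤ q := by exact_mod_cast Finset.mem_range.1 hk
          push_cast at this
          exact this.trans hqt
        simp only [hv, Set.indicator_of_mem hkt, le_refl]
      rcases lt_or_ge t ((m : ℝ) + 1) with htm | htm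
      · obtain ⟨k, hk⟩ : ∃ k, ⌊t⌋₊ = k + 1 :=
          Nat.exists_eq_succ_of_ne_zero (Nat.floor_pos.2 ht1).ne'
        have hk1 : ((k + 1 : ℕ) : ℝ) ≤ t := hk ▸ Nat.floor_le ht0.le
        have hk2 : t < ((k + 1 : ℕ) : ℝ) + 1 := hk ▸ Nat.lt_floor_add_one t
        have hkm : k < m := by
          have : ((k + 1 : ℕ) : ℝ) < ((m + 1 : ℕ) : ℝ) := by
            push_cast at hk1 ⊢
            linarith
          have : k + 1 < m + 1 := by exact_mod_cast this
          omega
        have hkI : t ∈ I k := by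
          push_cast at hk1 hk2
          exact ⟨hk1, hk2⟩
        refine (hmul (k + 1) (by omega) (by omega) hk1).trans
          (add_le_add ?_ (hvk (k + 1) (by omega) hk1))
        refine le_trans (le_of_eq ?_) (Finset.single_le_sum (f := fun k => u k t)
          (fun _ _ => zero_le) (Finset.mem_range.2 hkm))
        simp only [hu, Set.indicator_of_mem hkI]
      · have htm' : ((m + 1 : ℕ) : ℝ) ≤ t := by
          push_cast
          exact htm
        refine (hmul (m + 1) (by omega) le_rfl htm').trans ?_
        -- Beyond `m + 1` the choice `q = m + 1` is kept, and its Markov term vanishes.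
        rw [hθm]
        simp only [mul_zero, zero_mul, ENNReal.ofReal_zero, zero_add]
        exact le_add_left (hvk (m + 1) le_rfl htm')
  have hmeas : ∫⁻ t in Set.Ioi 0, μ {ω | t ≤ f ω} ≤ ENNReal.ofReal (a * (θ 0 / 4)) := by
    rw [← lintegral_eq_lintegral_meas_le μ (Filter.Eventually.of_forall hf0) hfi.aemeasurable,
      ← ofReal_integral_eq_lintegral_ofReal hfi (Filter.Eventually.of_forall hf0)]
    exact ENNReal.ofReal_le_ofReal hmean
  have hui : ∀ k, ∫⁻ t in Set.Ioi 0, u k t ≤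
      ENNReal.ofReal (a * (θ (k + 1) * ((w k + w (k + 1)) / 2))) := by
    intro k
    refine (setLIntegral_le_lintegral _ _).trans ?_
    rw [lintegral_indicator measurableSet_Ico]
    refine (lintegral_Ico_rpow_le (by linarith) (by positivity)
      (mul_nonneg ha (hθ0 _))).trans (le_of_eq ?_)
    simp only [hw]
    push_cast
    rw [mul_assoc]
  have hvi : ∀ k, ∫⁻ t in Set.Ioi 0, v k t ≤
      ENNReal.ofReal (b / (2 - p) * (w k * θ k)) := by
    intro k
    refine (setLIntegral_le_lintegral _ _).trans ?_
    rw [lintegral_indicator measurableSet_Ici,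
      lintegral_Ici_rpow_eq (by linarith) (by positivity) (mul_nonneg hb (hθ0 _))]
    refine le_of_eq ?_
    congr 1
    rw [show p - 3 + 1 = p - 2 by ring, show -(p - 2) = 2 - p by ring]
    simp only [hw]
    ring
  have hU0 : ∀ k, 0 ≤ a * (θ (k + 1) * ((w k + w (k + 1)) / 2)) := fun k =>
    mul_nonneg ha (mul_nonneg (hθ0 _) (by linarith [hw0 k, hw0 (k + 1)]))
  have hV0 : ∀ k, 0 ≤ b / (2 - p) * (w k * θ k) := fun k =>
    mul_nonneg (div_nonneg hb h2p.le) (mul_nonneg (hw0 k) (hθ0 k))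
  have hantim : Measurable fun t : ℝ => μ {ω | t ≤ f ω} :=
    Antitone.measurable fun s t hst => measure_mono fun ω hω => le_trans hst hω
  calc ∫⁻ t in Set.Ioi 0, μ {ω | t ≤ f ω} * ENNReal.ofReal (t ^ (p - 1))
      ≤ ∫⁻ t in Set.Ioi 0, (μ {ω | t ≤ f ω} +
          (∑ k ∈ Finset.range m, u k t + ∑ k ∈ Finset.range (m + 1), v k t)) :=
        setLIntegral_mono' measurableSet_Ioi hpoint
    _ = (∫⁻ t in Set.Ioi 0, μ {ω | t ≤ f ω}) +
          ((∑ k ∈ Finset.range m, ∫⁻ t in Set.Ioi 0, u k t) +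
            ∑ k ∈ Finset.range (m + 1), ∫⁻ t in Set.Ioi 0, v k t) := by
        rw [lintegral_add_left hantim, lintegral_add_left
          (Finset.measurable_fun_sum _ fun k _ => hum k), lintegral_finsetSum _ fun k _ => hum k,
          lintegral_finsetSum _ fun k _ => hvm k]
    _ ≤ ENNReal.ofReal (a * (θ 0 / 4)) +
          (∑ k ∈ Finset.range m, ENNReal.ofReal (a * (θ (k + 1) * ((w k + w (k + 1)) / 2))) +
            ∑ k ∈ Finset.range (m + 1), ENNReal.ofReal (b / (2 - p) * (w k * θ k))) :=
        add_le_add hmeas (add_le_add (Finset.sum_le_sum fun k _ => hui k)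
          (Finset.sum_le_sum fun k _ => hvi k))
    _ = ENNReal.ofReal (a * (θ 0 / 4 +
            ∑ k ∈ Finset.range m, θ (k + 1) * ((w k + w (k + 1)) / 2)) +
          b / (2 - p) * ∑ k ∈ Finset.range (m + 1), w k * θ k) := by
        rw [← ENNReal.ofReal_sum_of_nonneg fun k _ => hU0 k,
          ← ENNReal.ofReal_sum_of_nonneg fun k _ => hV0 k,
          ← ENNReal.ofReal_add (Finset.sum_nonneg fun k _ => hU0 k)
            (Finset.sum_nonneg fun k _ => hV0 k),
          ← ENNReal.ofReal_add (mul_nonneg ha (by linarith [hθ0 0]))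
            (add_nonneg (Finset.sum_nonneg fun k _ => hU0 k)
              (Finset.sum_nonneg fun k _ => hV0 k)),
          ← Finset.mul_sum, ← Finset.mul_sum]
        congr 1
        ring
    _ ≤ _ := by
        refine ENNReal.ofReal_le_ofReal ?_
        rw [add_mul]
        gcongr
        exact sum_trapezoid_le hθ0 hθ hw0 (by simp [hw]) m

end TailIntegration

/-! ### Reindexing from zero and extension to an infinite sequence -/

section PartialSums

variable {Ω B : Type*} [NormedAddCommGroup B] {Y : ℕ → Ω → B} {n : ℕ}

/-- The sequence `Y_1, …, Y_n`, indexed from zero and continued by zero. -/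
def truncatedSeq (Y : ℕ → Ω → B) (n i : ℕ) : Ω → B := if i < n then Y (i + 1) else 0

theorem partialSum_eq_sum_truncatedSeq {k : ℕ} (hk : k ≤ n) (ω : Ω) :
    partialSum Y k ω = ∑ i ∈ Finset.range k, truncatedSeq Y n i ω := by
  rw [partialSum, ← Finset.Ico_add_one_right_eq_Icc, Finset.sum_Ico_eq_sum_range]
  refine Finset.sum_congr (by simp) fun i hi => ?_
  have : i < n := by
    have := Finset.mem_range.1 hi
    omega
  rw [truncatedSeq, if_pos this, add_comm]

theorem maxPartialSum_nonneg (Y : ℕ → Ω → B) (n : ℕ) (ω : Ω) : 0 ≤ maxPartialSum Y n ω :=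
  Real.iSup_nonneg fun _ => norm_nonneg _

theorem exists_maxPartialSum_eq (hn : 1 ≤ n) (Y : ℕ → Ω → B) (ω : Ω) :
    ∃ k ≤ n, maxPartialSum Y n ω = ‖∑ i ∈ Finset.range k, truncatedSeq Y n i ω‖ := by
  have : Nonempty (Finset.Icc 1 n) := ⟨⟨1, Finset.mem_Icc.2 ⟨le_rfl, hn⟩⟩⟩
  obtain ⟨⟨k, hk⟩, h⟩ := exists_eq_ciSup_of_finite
    (f := fun k : Finset.Icc 1 n => ‖partialSum Y k ω‖)
  have hkn := (Finset.mem_Icc.1 hk).2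
  refine ⟨k, hkn, ?_⟩
  rw [← partialSum_eq_sum_truncatedSeq hkn]
  exact h.symm

theorem maxPartialSum_le_sum (hn : 1 ≤ n) (Y : ℕ → Ω → B) (ω : Ω) :
    maxPartialSum Y n ω ≤ ∑ i ∈ Finset.range n, ‖truncatedSeq Y n i ω‖ := by
  obtain ⟨k, hk, h⟩ := exists_maxPartialSum_eq hn Y ω
  rw [h]
  exact (norm_sum_le _ _).trans (Finset.sum_le_sum_of_subset_of_nonneg (Finset.range_mono hk)
    fun _ _ _ => norm_nonneg _)

variable [mΩ : MeasurableSpace Ω] {μ : Measure Ω} {F : ℕ → MeasurableSpace Ω} {M : ℝ}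

/-- The filtration `F_1 ⊆ ⋯ ⊆ F_n`, indexed from zero and continued by `F_n`. -/
def truncatedFiltration (F : ℕ → MeasurableSpace Ω) (hn : 1 ≤ n)
    (hF_le : ∀ k ∈ Finset.Icc 1 n, F k ≤ mΩ)
    (hF_mono : ∀ j ∈ Finset.Icc 1 n, ∀ k ∈ Finset.Icc 1 n, j ≤ k → F j ≤ F k) :
    Filtration ℕ mΩ where
  seq i := F (min (i + 1) n)
  mono' i j hij := hF_mono _ (Finset.mem_Icc.2 (by omega)) _ (Finset.mem_Icc.2 (by omega))
    (by omega)
  le' i := hF_le _ (Finset.mem_Icc.2 (by omega))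

theorem measurable_maxPartialSum (hY : ∀ i, StronglyMeasurable (truncatedSeq Y n i)) :
    Measurable (maxPartialSum Y n) := by
  refine Measurable.iSup fun k => ?_
  have : partialSum Y k = fun ω => ∑ i ∈ Finset.range k, truncatedSeq Y n i ω := by
    funext ω
    exact partialSum_eq_sum_truncatedSeq (Finset.mem_Icc.1 k.2).2 ω
  change Measurable fun ω => ‖partialSum Y k ω‖
  rw [this]
  exact (Finset.stronglyMeasurable_fun_sum _ fun i _ => hY i).norm.measurable

theorem stronglyAdapted_truncatedSeq (hn : 1 ≤ n) (hF_le : ∀ k ∈ Finset.Icc 1 n, F k ≤ mΩ)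
    (hF_mono : ∀ j ∈ Finset.Icc 1 n, ∀ k ∈ Finset.Icc 1 n, j ≤ k → F j ≤ F k)
    (hY_meas : ∀ k ∈ Finset.Icc 1 n, StronglyMeasurable[F k] (Y k)) :
    StronglyAdapted (truncatedFiltration F hn hF_le hF_mono) (truncatedSeq Y n) := by
  intro i
  by_cases h : i < n
  · have hG : truncatedFiltration F hn hF_le hF_mono i = F (i + 1) := by
      change F (min (i + 1) n) = _
      congr 1
      omega
    rw [hG, truncatedSeq, if_pos h]
    exact hY_meas _ (Finset.mem_Icc.2 (by omega))
  · rw [truncatedSeq, if_neg h]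
    exact stronglyMeasurable_zero

theorem ae_norm_truncatedSeq_le (hM : 0 ≤ M)
    (hY_bdd : ∀ k ∈ Finset.Icc 1 n, ∀ᵐ ω ∂μ, ‖Y k ω‖ ≤ M) (i : ℕ) :
    ∀ᵐ ω ∂μ, ‖truncatedSeq Y n i ω‖ ≤ M := by
  by_cases h : i < n
  · rw [truncatedSeq, if_pos h]
    exact hY_bdd _ (Finset.mem_Icc.2 (by omega))
  · rw [truncatedSeq, if_neg h]
    simp [hM]

theorem ae_maxPartialSum_le (hn : 1 ≤ n) (hM : 0 ≤ M)
    (hY_bdd : ∀ k ∈ Finset.Icc 1 n, ∀ᵐ ω ∂μ, ‖Y k ω‖ ≤ M) :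
    ∀ᵐ ω ∂μ, maxPartialSum Y n ω ≤ n * M := by
  filter_upwards [ae_all_iff.2 (ae_norm_truncatedSeq_le hM hY_bdd)] with ω hω
  refine (maxPartialSum_le_sum hn Y ω).trans ?_
  calc _ ≤ ∑ i ∈ Finset.range n, M := Finset.sum_le_sum fun i _ => hω i
    _ = n * M := by simp

theorem integrable_maxPartialSum_rpow [IsFiniteMeasure μ] (hn : 1 ≤ n) (hM : 0 ≤ M)
    (hF_le : ∀ k ∈ Finset.Icc 1 n, F k ≤ mΩ)
    (hY_meas : ∀ k ∈ Finset.Icc 1 n, StronglyMeasurable[F k] (Y k))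
    (hY_bdd : ∀ k ∈ Finset.Icc 1 n, ∀ᵐ ω ∂μ, ‖Y k ω‖ ≤ M) {p : ℝ} (hp : 0 ≤ p) :
    Integrable (fun ω => maxPartialSum Y n ω ^ p) μ := by
  have hY : ∀ i, StronglyMeasurable (truncatedSeq Y n i) := by
    intro i
    by_cases h : i < n
    · rw [truncatedSeq, if_pos h]
      exact (hY_meas _ (Finset.mem_Icc.2 (by omega))).mono (hF_le _ (Finset.mem_Icc.2 (by omega)))
    · rw [truncatedSeq, if_neg h]
      exact stronglyMeasurable_zero
  refine Integrable.of_bound ((measurable_maxPartialSum hY).pow_const p).aestronglyMeasurable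
    ((n * M) ^ p) ?_
  filter_upwards [ae_maxPartialSum_le hn hM hY_bdd] with ω hω
  have h0 := maxPartialSum_nonneg Y n ω
  rw [Real.norm_of_nonneg (Real.rpow_nonneg h0 _)]
  exact Real.rpow_le_rpow h0 hω hp

end PartialSums

/-! ### The coefficients `θ` -/

section Theta

variable {Ω B : Type*} [mΩ : MeasurableSpace Ω] [NormedAddCommGroup B] [NormedSpace ℝ B]
  [CompleteSpace B] {μ : Measure Ω} {F : ℕ → MeasurableSpace Ω} {Y : ℕ → Ω → B} {n : ℕ} {M : ℝ}

theorem theta_nonneg (μ : Measure Ω) (F : ℕ → MeasurableSpace Ω) (Y : ℕ → Ω → B) (n k : ℕ) :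
    0 ≤ theta μ F Y n k :=
  Real.iSup_nonneg fun _ => integral_nonneg fun _ => norm_nonneg _

/-- A supremum over the empty type is 0 in `ℝ`. This convention accounts for the indicator of `q <
n` and agrees with continuing the sequence by zero. -/
theorem theta_eq_zero_of_le {k : ℕ} (hk : n ≤ k) : theta μ F Y n k = 0 := by
  have : IsEmpty (Finset.Icc (k + 1) n) := ⟨fun i => by
    have := Finset.mem_Icc.1 i.2
    omega⟩
  exact Real.iSup_of_isEmpty _

theorem le_theta {i k : ℕ} (h1 : k + 1 ≤ i) (h2 : i ≤ n) :
    ∫ ω, ‖(μ[Y i | F (i - k)]) ω‖ ∂μ ≤ theta μ F Y n k :=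
  le_ciSup (f := fun i : Finset.Icc (k + 1) n => ∫ ω, ‖(μ[Y i | F (i - k)]) ω‖ ∂μ)
    (Set.finite_range _).bddAbove ⟨i, Finset.mem_Icc.2 ⟨h1, h2⟩⟩

theorem theta_antitone [IsFiniteMeasure μ] (hF_le : ∀ k ∈ Finset.Icc 1 n, F k ≤ mΩ)
    (hF_mono : ∀ j ∈ Finset.Icc 1 n, ∀ k ∈ Finset.Icc 1 n, j ≤ k → F j ≤ F k) :
    Antitone (theta μ F Y n) := by
  refine antitone_nat_of_succ_le fun k => ?_
  refine Real.iSup_le (fun i => ?_) (theta_nonneg μ F Y n k)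
  obtain ⟨i, hi⟩ := i
  rw [Finset.mem_Icc] at hi
  have hle := hF_le (i - k) (Finset.mem_Icc.2 (by omega))
  exact (integral_norm_condExp_antitone (hF_mono (i - (k + 1)) (Finset.mem_Icc.2 (by omega))
    (i - k) (Finset.mem_Icc.2 (by omega)) (by omega)) hle (Y i)).trans
    (le_theta (by omega) hi.2)

theorem integral_norm_condExp_truncatedSeq_le (hn : 1 ≤ n)
    (hF_le : ∀ k ∈ Finset.Icc 1 n, F k ≤ mΩ)
    (hF_mono : ∀ j ∈ Finset.Icc 1 n, ∀ k ∈ Finset.Icc 1 n, j ≤ k → F j ≤ F k) (k i : ℕ) :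
    ∫ ω, ‖(μ[truncatedSeq Y n (i + k) | truncatedFiltration F hn hF_le hF_mono i]) ω‖ ∂μ ≤
      theta μ F Y n k := by
  by_cases h : i + k < n
  · have hG : truncatedFiltration F hn hF_le hF_mono i = F (i + k + 1 - k) := by
      change F (min (i + 1) n) = _
      congr 1
      omega
    rw [hG, truncatedSeq, if_pos h]
    exact le_theta (by omega) (by omega)
  · rw [truncatedSeq, if_neg h, condExp_zero]
    simpa using theta_nonneg μ F Y n k

/-- The triangle inequality suffices, since `θ 0` is the largest `E|Y_i|`. This is the mean bound
used for small levels in the tail integration. -/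
theorem integral_maxPartialSum_le [IsFiniteMeasure μ] (hn : 1 ≤ n) (hM : 0 ≤ M)
    (hF_le : ∀ k ∈ Finset.Icc 1 n, F k ≤ mΩ)
    (hF_mono : ∀ j ∈ Finset.Icc 1 n, ∀ k ∈ Finset.Icc 1 n, j ≤ k → F j ≤ F k)
    (hY_meas : ∀ k ∈ Finset.Icc 1 n, StronglyMeasurable[F k] (Y k))
    (hY_bdd : ∀ k ∈ Finset.Icc 1 n, ∀ᵐ ω ∂μ, ‖Y k ω‖ ≤ M) :
    ∫ ω, maxPartialSum Y n ω ∂μ ≤ n * theta μ F Y n 0 := by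
  have hadp := stronglyAdapted_truncatedSeq hn hF_le hF_mono hY_meas
  have hint : ∀ i, Integrable (truncatedSeq Y n i) μ := fun i =>
    Integrable.of_bound ((hadp i).mono (Filtration.le _ i)).aestronglyMeasurable M
      (ae_norm_truncatedSeq_le hM hY_bdd i)
  have hmax : Integrable (maxPartialSum Y n) μ := by
    simpa using integrable_maxPartialSum_rpow hn hM hF_le hY_meas hY_bdd zero_le_one
  calc ∫ ω, maxPartialSum Y n ω ∂μ
      ≤ ∫ ω, ∑ i ∈ Finset.range n, ‖truncatedSeq Y n i ω‖ ∂μ :=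
        integral_mono hmax (integrable_finsetSum _ fun i _ => (hint i).norm)
          fun ω => maxPartialSum_le_sum hn Y ω
    _ = ∑ i ∈ Finset.range n, ∫ ω, ‖truncatedSeq Y n i ω‖ ∂μ :=
        integral_finsetSum _ fun i _ => (hint i).norm
    _ ≤ ∑ i ∈ Finset.range n, theta μ F Y n 0 := by
        refine Finset.sum_le_sum fun i _ => ?_
        have h := integral_norm_condExp_truncatedSeq_le (μ := μ) (Y := Y) hn hF_le hF_mono 0 i
        rwa [add_zero, condExp_of_stronglyMeasurable (Filtration.le _ i) (hadp i) (hint i)] at h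
    _ = n * theta μ F Y n 0 := by simp

end Theta

theorem maxPartialSum_of_subsingleton {Ω B : Type*} [NormedAddCommGroup B] [Subsingleton B]
    (Y : ℕ → Ω → B) (n : ℕ) (ω : Ω) : maxPartialSum Y n ω = 0 := by
  have : ∀ k : Finset.Icc 1 n, ‖partialSum Y k ω‖ = 0 := fun k => by
    rw [norm_eq_zero]
    exact Subsingleton.elim _ _
  simp [maxPartialSum, this]

theorem theta_of_subsingleton {Ω B : Type*} [MeasurableSpace Ω] [NormedAddCommGroup B]
    [NormedSpace ℝ B] [CompleteSpace B] [Subsingleton B] (μ : Measure Ω)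
    (F : ℕ → MeasurableSpace Ω) (Y : ℕ → Ω → B) (n k : ℕ) : theta μ F Y n k = 0 := by
  have : ∀ (i : Finset.Icc (k + 1) n) ω, ‖(μ[Y i | F (i - k)]) ω‖ = 0 := fun i ω => by
    rw [norm_eq_zero]
    exact Subsingleton.elim _ _
  simp [theta, this]

/-! ### Assembly -/

section Main

variable {Ω B : Type*} [mΩ : MeasurableSpace Ω] {μ : Measure Ω} [IsProbabilityMeasure μ]
  [NormedAddCommGroup B] [NormedSpace ℝ B] [CompleteSpace B] [Nontrivial B]
  {c : ℝ} {n : ℕ} {M : ℝ} {Y : ℕ → Ω → B} {F : ℕ → MeasurableSpace Ω}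

theorem ClassTilde.measure_maxPartialSum_le (hB : ClassTilde B 2 c) (hn : 1 ≤ n) (hM : 0 ≤ M)
    (hF_le : ∀ k ∈ Finset.Icc 1 n, F k ≤ mΩ)
    (hF_mono : ∀ j ∈ Finset.Icc 1 n, ∀ k ∈ Finset.Icc 1 n, j ≤ k → F j ≤ F k)
    (hY_meas : ∀ k ∈ Finset.Icc 1 n, StronglyMeasurable[F k] (Y k))
    (hY_bdd : ∀ k ∈ Finset.Icc 1 n, ∀ᵐ ω ∂μ, ‖Y k ω‖ ≤ M) {q : ℕ} (hq : 1 ≤ q) {x : ℝ}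
    (hx : 0 < x) (hqx : q * M ≤ x) :
    μ.real {ω | 4 * x ≤ maxPartialSum Y n ω} ≤
      n * theta μ F Y n q / x +
        4 * c ^ 2 * n * M / x ^ 2 * ∑ k ∈ Finset.range q, theta μ F Y n k := by
  refine le_trans (measureReal_mono fun ω hω => ?_) (hB.measure_max_sum_le
    (stronglyAdapted_truncatedSeq hn hF_le hF_mono hY_meas)
    (ae_norm_truncatedSeq_le hM hY_bdd)
    (integral_norm_condExp_truncatedSeq_le hn hF_le hF_mono) hq hx hqx n)
  obtain ⟨k, hk, h⟩ := exists_maxPartialSum_eq hn Y ω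
  exact ⟨k, hk, h ▸ hω⟩

theorem ClassTilde.integral_maxPartialSum_rpow_le (hB : ClassTilde B 2 c) (hn : 1 ≤ n)
    (hM : 0 < M) (hF_le : ∀ k ∈ Finset.Icc 1 n, F k ≤ mΩ)
    (hF_mono : ∀ j ∈ Finset.Icc 1 n, ∀ k ∈ Finset.Icc 1 n, j ≤ k → F j ≤ F k)
    (hY_meas : ∀ k ∈ Finset.Icc 1 n, StronglyMeasurable[F k] (Y k))
    (hY_bdd : ∀ k ∈ Finset.Icc 1 n, ∀ᵐ ω ∂μ, ‖Y k ω‖ ≤ M) {p : ℝ} (hp1 : 1 ≤ p) (hp2 : p < 2) :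
    ∫ ω, maxPartialSum Y n ω ^ p ∂μ ≤
      ((4 : ℝ) ^ p * p + (4 : ℝ) ^ (p + 1) * p * c ^ 2 / (2 - p)) * M ^ (p - 1) * n *
        ∑ k ∈ Finset.range n, ((k : ℝ) + 1) ^ (p - 2) * theta μ F Y n k := by
  obtain ⟨m, rfl⟩ : ∃ m, n = m + 1 := ⟨n - 1, by omega⟩
  set N : ℝ := ((m + 1 : ℕ) : ℝ) with hN
  have hN0 : 0 ≤ N := Nat.cast_nonneg _
  set θ := theta μ F Y (m + 1) with hθdef
  have hθ0 : ∀ k, 0 ≤ θ k := theta_nonneg μ F Y (m + 1)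
  have h4M : 0 < 4 * M := by positivity
  have h2p : 0 < 2 - p := by linarith
  have hmaxi : Integrable (maxPartialSum Y (m + 1)) μ := by
    simpa using integrable_maxPartialSum_rpow hn hM.le hF_le hY_meas hY_bdd zero_le_one
  have hmaxp := integrable_maxPartialSum_rpow hn hM.le hF_le hY_meas hY_bdd
    (show 0 ≤ p by linarith)
  -- With `x = y * M` the condition `q * M ≤ x` becomes `q ≤ y`, and the level `4 * x` for the
  -- maximum becomes `y` for `f`.
  set f : Ω → ℝ := fun ω => maxPartialSum Y (m + 1) ω / (4 * M) with hf
  have hf0 : ∀ ω, 0 ≤ f ω := fun ω => div_nonneg (maxPartialSum_nonneg _ _ _) h4M.le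
  have hfp : ∀ ω, f ω ^ p = maxPartialSum Y (m + 1) ω ^ p / (4 * M) ^ p := fun ω =>
    Real.div_rpow (maxPartialSum_nonneg _ _ _) h4M.le _
  have hmean : ∫ ω, f ω ∂μ ≤ N / M * (θ 0 / 4) := by
    have h := integral_maxPartialSum_le hn hM.le hF_le hF_mono hY_meas hY_bdd
    rw [← hN, ← hθdef] at h
    rw [integral_div, div_le_iff₀ h4M]
    refine h.trans (le_of_eq ?_)
    field_simp
  have htail : ∀ q, 1 ≤ q → q ≤ m + 1 → ∀ y : ℝ, (q : ℝ) ≤ y → μ.real {ω | y ≤ f ω} ≤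
      N / M * θ q / y + 4 * c ^ 2 * N / M / y ^ 2 * ∑ k ∈ Finset.range q, θ k := by
    intro q hq _ y hy
    have hy0 : 0 < y := lt_of_lt_of_le (by exact_mod_cast hq) hy
    have h := hB.measure_maxPartialSum_le hn hM.le hF_le hF_mono hY_meas hY_bdd hq
      (mul_pos hy0 hM) (by gcongr)
    rw [← hN, ← hθdef] at h
    have hset : {ω | y ≤ f ω} = {ω | 4 * (y * M) ≤ maxPartialSum Y (m + 1) ω} := by
      ext ω
      change y ≤ maxPartialSum Y (m + 1) ω / (4 * M) ↔ 4 * (y * M) ≤ maxPartialSum Y (m + 1) ω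
      rw [le_div_iff₀ h4M, show y * (4 * M) = 4 * (y * M) by ring]
    rw [hset]
    refine h.trans (le_of_eq ?_)
    field_simp
  have hmain := lintegral_rpow_le_of_tail_le hf0 (hmaxi.div_const _) hθ0
    (theta_antitone hF_le hF_mono) (div_nonneg hN0 hM.le)
    (div_nonneg (by positivity) hM.le : 0 ≤ 4 * c ^ 2 * N / M)
    (theta_eq_zero_of_le le_rfl) hmean htail hp1 hp2
  have hfpi : Integrable (fun ω => f ω ^ p) μ := by
    simp_rw [hfp]
    exact hmaxp.div_const _
  rw [← ofReal_integral_eq_lintegral_ofReal hfpi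
    (Filter.Eventually.of_forall fun ω => Real.rpow_nonneg (hf0 ω) _)] at hmain
  set W := ∑ k ∈ Finset.range (m + 1), ((k : ℝ) + 1) ^ (p - 2) * θ k with hW
  have hW0 : 0 ≤ W := Finset.sum_nonneg fun k _ =>
    mul_nonneg (Real.rpow_nonneg (by positivity) _) (hθ0 k)
  rw [ENNReal.ofReal_le_ofReal_iff (by positivity)] at hmain
  simp_rw [hfp] at hmain
  rw [integral_div, div_le_iff₀ (Real.rpow_pos_of_pos h4M _)] at hmain
  refine hmain.trans (le_of_eq ?_)
  rw [Real.mul_rpow (by norm_num) hM.le, Real.rpow_add_one (by norm_num),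
    Real.rpow_sub_one hM.ne']
  field_simp

end Main

end SmoothBanach

theorem mainTheorem11
    {Ω B : Type*} [mΩ : MeasurableSpace Ω] (μ : Measure Ω) [IsProbabilityMeasure μ]
    [NormedAddCommGroup B] [NormedSpace ℝ B] [CompleteSpace B]
    [TopologicalSpace.SeparableSpace B]
    (c : ℝ) (hB : SmoothBanach.ClassTilde B 2 c)
    (n : ℕ) (hn : 1 ≤ n) (M : ℝ)
    (Y : ℕ → Ω → B) (F : ℕ → MeasurableSpace Ω)
    (hF_le : ∀ k ∈ Finset.Icc 1 n, F k ≤ mΩ)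
    (hF_mono : ∀ j ∈ Finset.Icc 1 n, ∀ k ∈ Finset.Icc 1 n, j ≤ k → F j ≤ F k)
    (hY_meas : ∀ k ∈ Finset.Icc 1 n, StronglyMeasurable[F k] (Y k))
    (hY_bdd : ∀ k ∈ Finset.Icc 1 n, ∀ᵐ ω ∂μ, ‖Y k ω‖ ≤ M) :
    (∀ q ∈ Finset.Icc 1 n, ∀ x : ℝ, 0 < x → (q : ℝ) * M ≤ x →
      μ.real {ω | 4 * x ≤ SmoothBanach.maxPartialSum Y n ω} ≤
        (if q < n then (n : ℝ) * SmoothBanach.theta μ F Y n q / x else 0) +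
          4 * c * (√(max c 1)) ^ 2 * n * M / x ^ 2 *
            ∑ k ∈ Finset.range q, SmoothBanach.theta μ F Y n k) ∧
    (∀ p : ℝ, 1 ≤ p → p < 2 →
      Integrable (fun ω => SmoothBanach.maxPartialSum Y n ω ^ p) μ ∧
      ∫ ω, SmoothBanach.maxPartialSum Y n ω ^ p ∂μ ≤
        ((4 : ℝ) ^ p * p + (4 : ℝ) ^ (p + 1) * p * c * (√(max c 1)) ^ 2 / (2 - p)) *
          M ^ (p - 1) * n *
            ∑ k ∈ Finset.range n, ((k : ℝ) + 1) ^ (p - 2) * SmoothBanach.theta μ F Y n k ∧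
      ∫ ω, SmoothBanach.maxPartialSum Y n ω ^ p ∂μ ≤
        ((4 : ℝ) ^ p * p + (4 : ℝ) ^ (p + 1) * p * c * (√(max c 1)) ^ 2 / (2 - p)) *
          M ^ (p - 1) * n *
            ∑ k ∈ Finset.range n, ((k : ℝ) + 1) * SmoothBanach.theta μ F Y n k) := by
  -- On the zero space `c` may be any real satisfying no lower bound, but the maximum and all `θ`
  -- vanish.
  rcases subsingleton_or_nontrivial B with hsub | hnontriv
  · refine ⟨fun q _ x hx _ => ?_, fun p hp1 _ => ?_⟩
    · have h4x : ¬4 * x ≤ 0 := by linarith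
      simp [SmoothBanach.maxPartialSum_of_subsingleton, SmoothBanach.theta_of_subsingleton, h4x]
    · have hp : p ≠ 0 := by linarith
      simp [SmoothBanach.maxPartialSum_of_subsingleton, SmoothBanach.theta_of_subsingleton,
        Real.zero_rpow hp]
  have hc := hB.two_le
  have hM : 0 ≤ M := by
    obtain ⟨ω, hω⟩ := (hY_bdd 1 (Finset.mem_Icc.2 ⟨le_rfl, hn⟩)).exists
    exact (norm_nonneg _).trans hω
  have hK : (√(max c 1)) ^ 2 = c := by
    rw [max_eq_left (by linarith), Real.sq_sqrt (by linarith)]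
  rw [hK]
  refine ⟨fun q hq x hx hqx => ?_, fun p hp1 hp2 => ?_⟩
  · have h := hB.measure_maxPartialSum_le hn hM hF_le hF_mono hY_meas hY_bdd
      (Finset.mem_Icc.1 hq).1 hx hqx
    have hif : (if q < n then (n : ℝ) * SmoothBanach.theta μ F Y n q / x else 0) =
        n * SmoothBanach.theta μ F Y n q / x := by
      split_ifs with hqn
      · rfl
      · rw [SmoothBanach.theta_eq_zero_of_le (not_lt.1 hqn), mul_zero, zero_div]
    rw [hif, mul_assoc 4 c c, ← sq]
    exact h
  · have hθ0 := SmoothBanach.theta_nonneg μ F Y n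
    have hbound : ∫ ω, SmoothBanach.maxPartialSum Y n ω ^ p ∂μ ≤
        ((4 : ℝ) ^ p * p + (4 : ℝ) ^ (p + 1) * p * c * c / (2 - p)) * M ^ (p - 1) * n *
          ∑ k ∈ Finset.range n, ((k : ℝ) + 1) ^ (p - 2) * SmoothBanach.theta μ F Y n k := by
      -- Normalising by `4M` needs `M > 0`. If `M = 0` the maximum vanishes almost surely, and
      -- nonnegativity of the right side is enough, also for `p = 1`, where `0 ^ 0 = 1`.
      rcases hM.eq_or_lt with hM0 | hM0
      · have hzero : ∫ ω, SmoothBanach.maxPartialSum Y n ω ^ p ∂μ = 0 := by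
          refine integral_eq_zero_of_ae ?_
          filter_upwards [SmoothBanach.ae_maxPartialSum_le hn hM hY_bdd] with ω hω
          rw [← hM0, mul_zero] at hω
          rw [le_antisymm hω (SmoothBanach.maxPartialSum_nonneg Y n ω)]
          exact Real.zero_rpow (by linarith)
        rw [hzero]
        have h2p : 0 < 2 - p := by linarith
        have hS : 0 ≤ ∑ k ∈ Finset.range n,
            ((k : ℝ) + 1) ^ (p - 2) * SmoothBanach.theta μ F Y n k :=
          Finset.sum_nonneg fun k _ => mul_nonneg (Real.rpow_nonneg (by positivity) _) (hθ0 k)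
        have hMp : 0 ≤ M ^ (p - 1) := Real.rpow_nonneg hM _
        positivity
      · rw [mul_assoc _ c c, ← sq]
        exact hB.integral_maxPartialSum_rpow_le hn hM0 hF_le hF_mono hY_meas hY_bdd hp1 hp2
    refine ⟨SmoothBanach.integrable_maxPartialSum_rpow hn hM hF_le hY_meas hY_bdd (by linarith),
      hbound, hbound.trans ?_⟩
    have h2p : 0 < 2 - p := by linarith
    have hMp : 0 ≤ M ^ (p - 1) := Real.rpow_nonneg hM _
    refine mul_le_mul_of_nonneg_left (Finset.sum_le_sum fun k _ =>
      mul_le_mul_of_nonneg_right ?_ (hθ0 k)) (by positivity)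
    have hk : (1 : ℝ) ≤ (k : ℝ) + 1 := by linarith [(Nat.cast_nonneg k : (0 : ℝ) ≤ k)]
    calc ((k : ℝ) + 1) ^ (p - 2) ≤ ((k : ℝ) + 1) ^ (1 : ℝ) :=
          Real.rpow_le_rpow_of_exponent_le hk (by linarith)
      _ = (k : ℝ) + 1 := Real.rpow_one _
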